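/- **Setting.** Let $A$ be a $C^*$-algebra and let $X$ be a Hilbert $A$-bimodule, that is, a (complete) right-Hilbert $A$-module together with a $*$-homomorphism $\phi : A \to \mathcal{L}(X)$ into the adjointable operators (no injectivity or non-degeneracy is assumed). For a right-Hilbert $A$-module $Y$ put $\theta_{\xi,\eta}(\zeta)=\xi\langle\eta,\zeta\rangle$ and $\mathcal{K}(Y)=\overline{\mathrm{span}}\{\theta_{\xi,\eta}\mid \xi,\eta\in Y\}\subseteq\mathcal{L}(Y)$. Let $X_0=A$, $X_1=X$, and let $X_n=X^{\otimes n}$ be the balanced tensor powers over $A$, with left actions $\phi_0(a)=L_a$ (left multiplication), $\phi_1=\phi$, and $\phi_n(a)=\phi(a)\otimes 1$ for $n\ge 2$. Every element of $\mathcal{K}(X_0)$ is $L_a$ for a unique $a\in A$. A *representation* $(\pi,t)$ of $X$ in a $C^*$-algebra $B$ is a $*$-homomorphism $\pi:A\to B$ with a linear map $t:X\to B$ such that $t(\xi)^*t(\eta)=\pi(\langle\xi,\eta\rangle)$ and $\pi(a)t(\xi)=t(\phi(a)\xi)$. Put $t_0=\pi$, $t_n(\xi_1\otimes\cdots\otimes\xi_n)=t(\xi_1)\cdots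 t(\xi_n)$, let $t^{(n)}:\mathcal{K}(X_n)\to B$ be the $*$-homomorphism with $t^{(n)}(\theta_{\xi,\eta})=t_n(\xi)t_n(\eta)^*$, and let $C^*(\pi,t)^{\mathrm{core}}=\overline{\mathrm{span}}\{t_n(\xi)t_n(\eta)^*\mid n\ge 0,\ \xi,\eta\in X_n\}$. For $p\le q$ let $\iota_p^q:\mathcal{K}(X_p)\to\mathcal{L}(X_q)$ be given by $\iota_p^q(S)=S\otimes 1_{q-p}$ if $0<p<q$, $\iota_0^q(L_a)=\phi_q(a)$, and $\iota_p^p(S)=S$. Let $I_0=A$ and $I_n=\bigcap_{0<m\le n}\ker\phi_m$ for $n\ge1$, and let $YI=\{\xi\in Y\mid\langle\xi,\xi\rangle\in I\}$ for a right-Hilbert $A$-module $Y$ and an ideal $I$ of $A$. For $p,n\ge 0$ and $S\in\mathcal{K}(X_p)$ let $$\widetilde\iota_p^{\,n}(S)\in\bigoplus_{q=0}^n\mathcal{L}(X_qI_{n-q})$$ have $q$-th component $\iota_p^q(S)|_{X_qI_{n-q}}$ if $p\le q$ and $0$ if $q<p$, and let $C_n=\mathrm{span}\{\widetilde\iota_p^{\,n}(S)\mid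 0\le p\le n,\ S\in\mathcal{K}(X_p)\}$, which is a $*$-subalgebra. **Theorem.** For every representation $(\pi,t)$ of $X$ in a $C^*$-algebra $B$ the following are equivalent. 1. $(\pi,t)$ is *Cuntz–Pimsner covariant* (in Katsura's sense): $\pi(a)=t^{(1)}(\phi(a))$ for all $a\in J_X=\{a\in A\mid\phi(a)\in\mathcal{K}(X)\text{ and }ab=0\text{ for all }b\in\ker\phi\}$. 2. For each $n\ge 0$ the formula $\kappa_n^{(\pi,t)}\bigl(\sum_{p\le n}\widetilde\iota_p^{\,n}(S_p)\bigr)=\sum_{p\le n}t^{(p)}(S_p)$, for $S_p\in\mathcal{K}(X_p)$, gives a well-defined $*$-homomorphism $\kappa_n^{(\pi,t)}:C_n\to C^*(\pi,t)^{\mathrm{core}}$. 3. $(\pi,t)$ is *CNP-covariant* (in Sims–Yeend's sense, for the product system $(X_n)_{n\ge0}$ over $\mathbb{N}$): it is Nica covariant, that is, $t^{(m)}(S)\,t^{(n)}(T)=t^{(m\vee n)}\bigl(\iota_m^{m\vee n}(S)\,\iota_n^{m\vee n}(T)\bigr)$ for all $m,n\ge0$, $S\in\mathcal{K}(X_m)$,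 $T\in\mathcal{K}(X_n)$; and, whenever $F\subset\mathbb{N}$ is finite, $S_p\in\mathcal{K}(X_p)$ for $p\in F$, and for every $n$ there is $m\ge n$ such that $\sum_{p\in F}\widetilde\iota_p^{\,q}(S_p)=0$ for all $q\ge m$, one has $\sum_{p\in F}t^{(p)}(S_p)=0$. -/

import Mathlib

universe u v

noncomputable section

open MulOpposite UniformSpace

/-- A right-Hilbert `A`-module structure on a normed space `Y`: a right action of `A` (written
`op a • y` for `y a`) and an `A`-valued inner product, linear in the second variable, whose norm is
the norm of `Y`. Completeness is the separate assumption `CompleteSpace Y`. -/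
class HilbertModule (A : Type*) (Y : Type*) [NonUnitalCStarAlgebra A] [PartialOrder A]
    [NormedAddCommGroup Y] [NormedSpace ℂ Y] extends Inner A Y, SMul Aᵐᵒᵖ Y where
  inner_add (x y z : Y) : inner x (y + z) = inner x y + inner x z
  inner_smul (x y : Y) (c : ℂ) : inner x (c • y) = c • inner x y
  inner_op_smul (x y : Y) (a : A) : inner x (op a • y) = inner x y * a
  star_inner (x y : Y) : star (inner x y) = inner y x
  self_nonneg (x : Y) : 0 ≤ inner x x
  norm_sq_eq (x : Y) : ‖x‖ ^ 2 = ‖inner x x‖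

section CauchySchwarz

variable {A : Type*} [NonUnitalCStarAlgebra A] [PartialOrder A] [StarOrderedRing A]

theorem semiInner_star_mul_le {V : Type*} [AddCommGroup V] [Module ℂ V] (s : V → V → A)
    (r : A → V → V)
    (hadd : ∀ x y z, s x (y + z) = s x y + s x z)
    (hsmul : ∀ x y (c : ℂ), s x (c • y) = c • s x y)
    (hr : ∀ x y a, s x (r a y) = s x y * a)
    (hstar : ∀ x y, star (s x y) = s y x)
    (hpos : ∀ x, 0 ≤ s x x) (x y : V) (t : ℝ) (ht : ‖s x x‖ < t) :
    star (s x y) * s x y ≤ t • s y y := by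
  have hadd' : ∀ x y z, s (x + y) z = s x z + s y z := fun x y z => by
    rw [← hstar, hadd, star_add, hstar, hstar]
  have hsmul' : ∀ x y (c : ℂ), s (c • x) y = star c • s x y := fun x y c => by
    rw [← hstar, hsmul, star_smul, hstar]
  have hr' : ∀ x y a, s (r a x) y = star a * s x y := fun x y a => by
    rw [← hstar, hr, star_mul, hstar]
  have ht0 : 0 < t := (norm_nonneg _).trans_lt ht
  set a := s x y with ha
  have ha' : s y x = star a := (hstar x y).symm
  have h1 := hpos (r a x + (-(t : ℂ)) • y)
  rw [hadd, hadd', hadd', hr, hr, hr', hsmul', hsmul', hsmul, hsmul, ha', hr', ← ha] at h1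
  have h2 : star a * s x x * a ≤ t • (star a * a) := by
    refine (CStarAlgebra.star_left_conjugate_le_norm_smul
      (hb := (hstar x x : IsSelfAdjoint _))).trans ?_
    exact smul_le_smul_of_nonneg_right ht.le (star_mul_self_nonneg a)
  have h3 : t • (star a * a) ≤ (t * t) • s y y := by
    have e : star a * s x x * a + star (-(t : ℂ)) • (star a * a) +
        ((-(t : ℂ)) • (star a * a) + star (-(t:ℂ)) • (-(t:ℂ)) • s y y)
        = star a * s x x * a - t • (star a * a) - (t • (star a * a) - (t * t) • s y y) := by
      simp only [← Complex.coe_smul, star_neg, Complex.star_def, Complex.conj_ofReal, smul_smul]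
      push_cast
      module
    have h4 : 0 ≤ star a * s x x * a - t • (star a * a) - (t • (star a * a) - (t * t) • s y y) := by
      rw [← e]
      convert h1 using 1
      simp only [neg_smul, smul_neg, star_neg, neg_mul, smul_mul_assoc]
    rw [sub_nonneg] at h4
    exact sub_nonpos.mp (h4.trans (sub_nonpos.mpr h2))
  rw [mul_smul] at h3
  exact (smul_le_smul_iff_of_pos_left ht0).mp h3

theorem norm_semiInner_le {V : Type*} [AddCommGroup V] [Module ℂ V] (s : V → V → A)
    (r : A → V → V)
    (hadd : ∀ x y z, s x (y + z) = s x y + s x z)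
    (hsmul : ∀ x y (c : ℂ), s x (c • y) = c • s x y)
    (hr : ∀ x y a, s x (r a y) = s x y * a)
    (hstar : ∀ x y, star (s x y) = s y x)
    (hpos : ∀ x, 0 ≤ s x x) (x y : V) :
    ‖s x y‖ ≤ √‖s x x‖ * √‖s y y‖ := by
  have h : ∀ t, ‖s x x‖ < t → ‖s x y‖ ^ 2 ≤ t * ‖s y y‖ := fun t ht => by
    have := CStarAlgebra.norm_le_norm_of_nonneg_of_le (star_mul_self_nonneg _)
      (semiInner_star_mul_le s r hadd hsmul hr hstar hpos x y t ht)
    rwa [CStarRing.norm_star_mul_self, norm_smul, Real.norm_of_nonneg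
      ((norm_nonneg _).trans ht.le), ← sq] at this
  have h2 : ‖s x y‖ ^ 2 ≤ ‖s x x‖ * ‖s y y‖ := by
    have hc : Filter.Tendsto (fun t => t * ‖s y y‖) (nhdsWithin ‖s x x‖ (Set.Ioi ‖s x x‖))
        (nhds (‖s x x‖ * ‖s y y‖)) :=
      ((continuous_id.mul continuous_const).tendsto _).mono_left nhdsWithin_le_nhds
    refine ge_of_tendsto hc ?_
    filter_upwards [self_mem_nhdsWithin] with t ht using h t ht
  rw [← Real.sqrt_mul (norm_nonneg _)]
  exact Real.le_sqrt_of_sq_le h2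

end CauchySchwarz

namespace HilbertModule

variable {A : Type*} [NonUnitalCStarAlgebra A] [PartialOrder A]
variable {Y : Type*} [NormedAddCommGroup Y] [NormedSpace ℂ Y] [HilbertModule A Y]

theorem add_inner (x y z : Y) : inner A (x + y) z = inner A x z + inner A y z := by
  rw [← star_inner, inner_add, star_add, star_inner, star_inner]

theorem smul_inner (x y : Y) (c : ℂ) : inner A (c • x) y = star c • inner A x y := by
  rw [← star_inner, inner_smul, star_smul, star_inner]

theorem op_smul_inner (x y : Y) (a : A) :
    inner A (op a • x) y = star a * inner A x y := by
  rw [← star_inner, inner_op_smul, star_mul, star_inner]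

theorem norm_op_smul_le (a : A) (y : Y) : ‖op a • y‖ ≤ ‖y‖ * ‖a‖ := by
  refine le_of_sq_le_sq ?_ (by positivity)
  rw [norm_sq_eq (A := A), inner_op_smul, op_smul_inner, mul_pow, norm_sq_eq (A := A) y]
  calc _ ≤ ‖star a‖ * ‖inner A y y‖ * ‖a‖ :=
        (norm_mul_le _ _).trans (by gcongr; exact norm_mul_le _ _)
    _ = _ := by rw [norm_star]; ring

variable [StarOrderedRing A]

theorem norm_inner_le (x y : Y) : ‖inner A x y‖ ≤ ‖x‖ * ‖y‖ := by
  have := norm_semiInner_le (inner A : Y → Y → A) (fun a y => op a • y) inner_add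
    inner_smul inner_op_smul star_inner self_nonneg x y
  rwa [← norm_sq_eq, ← norm_sq_eq, Real.sqrt_sq (norm_nonneg _),
    Real.sqrt_sq (norm_nonneg _)] at this

variable (A) in
/-- The inner product as a continuous linear map in the second variable. -/
def innerCLM (x : Y) : Y →L[ℂ] A :=
  LinearMap.mkContinuous
    { toFun := fun y => inner A x y
      map_add' := inner_add x
      map_smul' := fun c y => inner_smul x y c } ‖x‖ (fun y => norm_inner_le x y)

@[simp] theorem innerCLM_apply (x y : Y) : innerCLM A x y = inner A x y := rfl

theorem inner_sub (x y z : Y) : inner A x (y - z) = inner A x y - inner A x z :=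
  map_sub (innerCLM A x) y z

theorem inner_zero (x : Y) : inner A x (0 : Y) = 0 := map_zero (innerCLM A x)

theorem zero_inner (x : Y) : inner A (0 : Y) x = 0 := by
  rw [← star_inner, inner_zero, star_zero]

theorem sub_inner (x y z : Y) : inner A (x - y) z = inner A x z - inner A y z := by
  rw [← star_inner, inner_sub, star_sub, star_inner, star_inner]

theorem eq_of_inner {x y : Y} (h : ∀ z : Y, inner A z x = inner A z y) : x = y := by
  rw [← sub_eq_zero, ← norm_eq_zero, ← sq_eq_zero_iff, norm_sq_eq (A := A), inner_sub, h,
    sub_self, norm_zero]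

variable (A) in
theorem continuous_inner_left (y : Y) : Continuous fun x : Y => inner A x y := by
  simp_rw [← star_inner (A := A) y]
  exact continuous_star.comp (innerCLM A y).continuous

end HilbertModule

open HilbertModule

section Adjointable

variable (A : Type*) [NonUnitalCStarAlgebra A] [PartialOrder A] [StarOrderedRing A]
variable (Y : Type*) [NormedAddCommGroup Y] [NormedSpace ℂ Y] [HilbertModule A Y]

/-- The algebra `𝓛(Y)` of adjointable operators on `Y`. -/
def Adjointable : Subalgebra ℂ (Y →L[ℂ] Y) where
  carrier := {T | ∃ T' : Y →L[ℂ] Y, ∀ x y, inner A (T x) y = inner A x (T' y)}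
  mul_mem' := by
    rintro S T ⟨S', hS⟩ ⟨T', hT⟩
    exact ⟨T' * S', fun x y => by simp [hS, hT]⟩
  add_mem' := by
    rintro S T ⟨S', hS⟩ ⟨T', hT⟩
    exact ⟨S' + T', fun x y => by simp [add_inner, inner_add, hS, hT]⟩
  algebraMap_mem' c := ⟨algebraMap ℂ _ (star c), fun x y => by
    simp [Algebra.algebraMap_eq_smul_one, smul_inner, inner_smul]⟩

variable {A Y}

namespace Adjointable

instance : NonUnitalNonAssocSemiring (Adjointable A Y) := inferInstance
instance : Module ℂ (Adjointable A Y) := inferInstance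
instance : DistribMulAction ℂ (Adjointable A Y) := inferInstance
instance : Mul (Adjointable A Y) := inferInstance
instance : Add (Adjointable A Y) := inferInstance
instance : Zero (Adjointable A Y) := inferInstance
instance : AddCommMonoid (Adjointable A Y) := inferInstance

/-- The adjointable operator `T` with adjoint `T'`. -/
def mk (T T' : Y →L[ℂ] Y) (h : ∀ x y, inner A (T x) y = inner A x (T' y)) : Adjointable A Y :=
  ⟨T, T', h⟩

instance : Star (Adjointable A Y) where
  star T := ⟨T.2.choose, T.1, fun x y => by
    rw [← star_inner, ← T.2.choose_spec, star_inner]⟩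

theorem inner_left (T : Adjointable A Y) (x y : Y) :
    inner A (T.1 x) y = inner A x ((star T).1 y) := T.2.choose_spec x y

theorem inner_right (T : Adjointable A Y) (x y : Y) :
    inner A x (T.1 y) = inner A ((star T).1 x) y := by
  rw [← star_inner, inner_left, star_inner]

theorem ext_inner {S T : Adjointable A Y}
    (h : ∀ x y, inner A x (S.1 y) = inner A x (T.1 y)) : S = T :=
  Subtype.ext <| ContinuousLinearMap.ext fun y => eq_of_inner (A := A) fun x => h x y

theorem star_eq {S T : Adjointable A Y}
    (h : ∀ x y, inner A (S.1 x) y = inner A x (T.1 y)) : star S = T :=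
  ext_inner fun x y => by rw [← inner_left, h]

instance : StarRing (Adjointable A Y) where
  star_involutive T := star_eq fun x y => by rw [inner_right]
  star_mul S T := star_eq fun x y => by
    simp only [MulMemClass.coe_mul, mul_apply_eq_comp, inner_left]
  star_add S T := star_eq fun x y => by
    simp only [Subalgebra.coe_add, add_apply, inner_left, add_inner,
      inner_add]

instance : StarModule ℂ (Adjointable A Y) where
  star_smul c T := star_eq fun x y => by
    simp only [SetLike.val_smul, smul_apply, inner_left, smul_inner,
      inner_smul]

instance : CStarRing (Adjointable A Y) where
  norm_mul_self_le T := by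
    change ‖T.1‖ * ‖T.1‖ ≤ ‖(star T * T).1‖
    rw [← sq]
    refine (Real.le_sqrt (norm_nonneg _) (norm_nonneg _)).mp ?_
    refine ContinuousLinearMap.opNorm_le_bound _ (Real.sqrt_nonneg _) fun x => ?_
    refine le_of_sq_le_sq ?_ (by positivity)
    rw [mul_pow, Real.sq_sqrt (norm_nonneg _), norm_sq_eq (A := A), inner_left]
    refine (norm_inner_le _ _).trans ?_
    calc _ ≤ ‖x‖ * (‖(star T * T).1‖ * ‖x‖) := by
          gcongr; exact (star T * T).1.le_opNorm x
      _ = _ := by ring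

instance : ContinuousConstSMul ℂ (Adjointable A Y) where
  continuous_const_smul c :=
    ((continuous_const_smul c).comp continuous_subtype_val).subtype_mk _

instance : ContinuousStar (Adjointable A Y) where
  continuous_star :=
    (CStarRing.to_normedStarGroup (E := Adjointable A Y)).to_continuousStar.continuous_star

variable [CompleteSpace Y]

instance : CompleteSpace (Adjointable A Y) := by
  refine Metric.complete_of_cauchySeq_tendsto fun T hT => ?_
  have h1 : CauchySeq fun n => (T n).1 := hT.map uniformContinuous_subtype_val
  have h2 : CauchySeq fun n => (star (T n)).1 :=
    (hT.map (star_isometry (E := Adjointable A Y)).uniformContinuous).map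
      uniformContinuous_subtype_val
  obtain ⟨S, hS⟩ := cauchySeq_tendsto_of_complete h1
  obtain ⟨S', hS'⟩ := cauchySeq_tendsto_of_complete h2
  have hmem : S ∈ Adjointable A Y := ⟨S', fun x y => by
    have e1 : Filter.Tendsto (fun n => inner A ((T n).1 x) y) Filter.atTop
        (nhds (inner A (S x) y)) :=
      ((continuous_inner_left A y).tendsto _).comp
        (((ContinuousLinearMap.apply ℂ Y x).continuous.tendsto S).comp hS)
    have e2 : Filter.Tendsto (fun n => inner A x ((star (T n)).1 y)) Filter.atTop
        (nhds (inner A x (S' y))) :=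
      ((innerCLM A x).continuous.tendsto _).comp
        (((ContinuousLinearMap.apply ℂ Y y).continuous.tendsto S').comp hS')
    refine tendsto_nhds_unique e1 (e2.congr fun n => ?_)
    rw [inner_left]⟩
  exact ⟨⟨S, hmem⟩, tendsto_subtype_rng.mpr hS⟩

instance : CStarAlgebra (Adjointable A Y) where

instance : NonUnitalCStarAlgebra (Adjointable A Y) := inferInstance

end Adjointable
end Adjointable
end

noncomputable section
open MulOpposite UniformSpace HilbertModule
open scoped TensorProduct

section Gram

variable {A : Type*} [NonUnitalCStarAlgebra A] [PartialOrder A] [StarOrderedRing A]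

theorem exists_eq_star_mul_self {M : Type*} [NonUnitalCStarAlgebra M] [PartialOrder M]
    [StarOrderedRing M] {a : M} (ha : 0 ≤ a) : ∃ b, a = star b * b :=
  CStarAlgebra.nonneg_iff_eq_star_mul_self.mp ha

theorem exists_negPart {M : Type*} [NonUnitalCStarAlgebra M] [PartialOrder M]
    [StarOrderedRing M] (P : M) (hP : star P = P) :
    ∃ N c : M, star N = N ∧ N * P * N = -(star c * c) ∧ (c = 0 → 0 ≤ P) := by
  have hsa : IsSelfAdjoint P := hP
  have hN0 : 0 ≤ P⁻ := CFC.negPart_nonneg P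
  have hNs : star P⁻ = P⁻ := (IsSelfAdjoint.of_nonneg hN0).star_eq
  have e1 : P⁻ * P * P⁻ = -(P⁻ * P⁻ * P⁻) := by
    nth_rewrite 2 [← CFC.posPart_sub_negPart P hsa]
    rw [mul_sub, CFC.negPart_mul_posPart]
    simp
  have h3 : 0 ≤ P⁻ * P⁻ * P⁻ := conjugate_nonneg_of_nonneg hN0 hN0
  obtain ⟨c, hc⟩ := exists_eq_star_mul_self h3
  refine ⟨P⁻, c, hNs, by rw [e1, hc], fun hc0 => ?_⟩
  have h8 : P⁻ * P⁻ * P⁻ = 0 := by rw [hc, hc0, mul_zero]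
  have h9 : P⁻ * P⁻ = 0 := by
    rw [← CStarRing.star_mul_self_eq_zero_iff, star_mul, hNs, ← mul_assoc, h8, zero_mul]
  have h10 : P⁻ = 0 := by
    rw [← CStarRing.star_mul_self_eq_zero_iff, hNs, h9]
  exact (CFC.negPart_eq_zero_iff P hsa).mp h10

theorem CStarMatrix.nonneg_of_forall {n : Type*} [Fintype n] (P : CStarMatrix n n A)
    (hP : star P = P) (h : ∀ v : n → A, 0 ≤ ∑ i, ∑ j, star (v i) * P i j * v j) : 0 ≤ P := by
  obtain ⟨N, c, hNs, e1, hc⟩ := exists_negPart P hP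
  refine hc ?_
  ext k j
  have h4 : 0 ≤ (N * P * N) j j := by
    have := h (fun i => N i j)
    convert this using 1
    simp only [CStarMatrix.mul_apply, Finset.sum_mul]
    rw [Finset.sum_comm]
    refine Finset.sum_congr rfl fun i _ => Finset.sum_congr rfl fun l _ => ?_
    rw [← CStarMatrix.star_apply, hNs]
  have h5 : (N * P * N) j j = -∑ k, star (c k j) * c k j := by
    rw [e1]
    change -((star c * c) j j) = _
    rw [CStarMatrix.mul_apply]
    simp only [CStarMatrix.star_apply]
  rw [h5] at h4
  have h6 := le_antisymm (neg_nonneg.mp h4)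
    (Finset.sum_nonneg fun k _ => star_mul_self_nonneg (c k j))
  have h7 := (Finset.sum_eq_zero_iff_of_nonneg
    (fun k _ => star_mul_self_nonneg (c k j))).mp h6 k (Finset.mem_univ _)
  exact (CStarRing.star_mul_self_eq_zero_iff _).mp h7

variable {X : Type*} [NormedAddCommGroup X] [NormedSpace ℂ X] [HilbertModule A X] [CompleteSpace X]
variable {Y : Type*} [NormedAddCommGroup Y] [NormedSpace ℂ Y] [HilbertModule A Y]

theorem HilbertModule.sum_inner {ι : Type*} (s : Finset ι) (f : ι → Y) (y : Y) :
    inner A (∑ i ∈ s, f i) y = ∑ i ∈ s, inner A (f i) y := by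
  classical
  induction s using Finset.induction_on with
  | empty => simp [zero_inner]
  | insert a s ha ih => rw [Finset.sum_insert ha, Finset.sum_insert ha, add_inner, ih]

theorem HilbertModule.inner_sum {ι : Type*} (s : Finset ι) (f : ι → Y) (y : Y) :
    inner A y (∑ i ∈ s, f i) = ∑ i ∈ s, inner A y (f i) := map_sum (innerCLM A y) f s

/-- Right multiplication by `a` as a linear map. -/
def opSMulLM (a : A) : Y →ₗ[ℂ] Y where
  toFun y := op a • y
  map_add' x y := eq_of_inner (A := A) fun z => by
    simp only [inner_add, inner_op_smul, add_mul]
  map_smul' c x := eq_of_inner (A := A) fun z => by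
    simp only [inner_smul, inner_op_smul, smul_mul_assoc, RingHom.id_apply]

theorem gram_nonneg (φ : A →⋆ₙₐ[ℂ] Adjointable A X) {n : Type*} [Fintype n]
    (ξ : n → Y) (η : n → X) :
    0 ≤ ∑ i, ∑ j, inner A (η i) ((φ (inner A (ξ i) (ξ j))).1 (η j)) := by
  let P : CStarMatrix n n A := CStarMatrix.ofMatrix fun i j => inner A (ξ i) (ξ j)
  have hP : 0 ≤ P := by
    refine CStarMatrix.nonneg_of_forall P ?_ fun v => ?_
    · ext i j
      rw [CStarMatrix.star_apply]
      exact star_inner _ _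
    · have := self_nonneg (A := A) (∑ i, op (v i) • ξ i)
      rw [HilbertModule.sum_inner] at this
      convert this using 1
      refine Finset.sum_congr rfl fun i _ => ?_
      rw [HilbertModule.inner_sum]
      refine Finset.sum_congr rfl fun j _ => ?_
      rw [inner_op_smul, op_smul_inner]
      rfl
  obtain ⟨Q, hQ⟩ := exists_eq_star_mul_self hP
  have e : ∀ i j, inner A (ξ i) (ξ j) = ∑ k, star (Q k i) * Q k j := fun i j => by
    have : P i j = (star Q * Q) i j := by rw [← hQ]
    rw [CStarMatrix.mul_apply] at this
    refine this.trans (Finset.sum_congr rfl fun k _ => ?_)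
    rw [CStarMatrix.star_apply]
  have e2 : ∀ i j, inner A (η i) ((φ (inner A (ξ i) (ξ j))).1 (η j)) =
      ∑ k, inner A ((φ (Q k i)).1 (η i)) ((φ (Q k j)).1 (η j)) := fun i j => by
    rw [e, map_sum, AddSubmonoidClass.coe_finsetSum, sum_apply,
      HilbertModule.inner_sum]
    refine Finset.sum_congr rfl fun k _ => ?_
    rw [map_mul, map_star, Adjointable.inner_left]
    rfl
  have : ∑ i, ∑ j, inner A (η i) ((φ (inner A (ξ i) (ξ j))).1 (η j)) =
      ∑ k, inner A (∑ i, (φ (Q k i)).1 (η i)) (∑ j, (φ (Q k j)).1 (η j)) := by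
    simp only [e2]
    simp_rw [HilbertModule.sum_inner, HilbertModule.inner_sum]
    rw [Finset.sum_comm_cycle]
  rw [this]
  exact Finset.sum_nonneg fun k _ => self_nonneg _

end Gram

section Tensor

variable {A : Type*} [NonUnitalCStarAlgebra A] [PartialOrder A] [StarOrderedRing A]
variable {X : Type*} [NormedAddCommGroup X] [NormedSpace ℂ X] [HilbertModule A X] [CompleteSpace X]

/-- The algebraic tensor product `Y ⊗ X` (over `ℂ`), to be equipped with the semi-inner product
`⟨ξ ⊗ η, ξ' ⊗ η'⟩ = ⟨η, φ(⟨ξ, ξ'⟩) η'⟩`. -/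
def PreTensor (Y : Type*) [NormedAddCommGroup Y] [NormedSpace ℂ Y] [HilbertModule A Y]
    (_φ : A →⋆ₙₐ[ℂ] Adjointable A X) : Type _ := Y ⊗[ℂ] X

variable {Y : Type*} [NormedAddCommGroup Y] [NormedSpace ℂ Y] [HilbertModule A Y]
variable (φ : A →⋆ₙₐ[ℂ] Adjointable A X)

namespace PreTensor

instance : AddCommGroup (PreTensor Y φ) := inferInstanceAs (AddCommGroup (Y ⊗[ℂ] X))
instance : Module ℂ (PreTensor Y φ) := inferInstanceAs (Module ℂ (Y ⊗[ℂ] X))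

/-- The semi-inner product on the algebraic tensor product. -/
def semiInner : (Y ⊗[ℂ] X) →ₗ⋆[ℂ] (Y ⊗[ℂ] X) →ₗ[ℂ] A :=
  TensorProduct.lift <| LinearMap.mk₂'ₛₗ (starRingEnd ℂ) (starRingEnd ℂ)
    (fun ξ η => TensorProduct.lift <| LinearMap.mk₂ ℂ
      (fun ξ' η' => inner A η ((φ (inner A ξ ξ')).1 η'))
      (fun _ _ _ => by simp [inner_add])
      (fun _ _ _ => by simp [inner_smul])
      (fun _ _ _ => by simp [inner_add])
      (fun _ _ _ => by simp [inner_smul]))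
    (fun _ _ _ => TensorProduct.ext' fun _ _ => by simp [inner_add, add_inner])
    (fun _ _ _ => TensorProduct.ext' fun _ _ => by simp [inner_smul, smul_inner])
    (fun _ _ _ => TensorProduct.ext' fun _ _ => by simp [add_inner])
    (fun _ _ _ => TensorProduct.ext' fun _ _ => by simp [smul_inner])

instance : Inner A (PreTensor Y φ) := ⟨fun u v => semiInner φ u v⟩


theorem inner_def (u v : PreTensor Y φ) : inner A u v = semiInner φ u v := rfl

theorem semiInner_tmul (ξ ξ' : Y) (η η' : X) :
    semiInner φ (ξ ⊗ₜ η) (ξ' ⊗ₜ η') = inner A η ((φ (inner A ξ ξ')).1 η') := rfl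

theorem star_semiInner (u v : Y ⊗[ℂ] X) : star (semiInner φ u v) = semiInner φ v u := by
  induction u with
  | zero => simp
  | add x y hx hy => simp [hx, hy]
  | tmul ξ η =>
    induction v with
    | zero => simp
    | add x y hx hy => simp [hx, hy]
    | tmul ξ' η' =>
      rw [semiInner_tmul, semiInner_tmul, star_inner, Adjointable.inner_left, ← map_star,
        star_inner]

theorem semiInner_self_nonneg (u : Y ⊗[ℂ] X) : 0 ≤ semiInner φ u u := by
  obtain ⟨k, ξ, η, rfl⟩ := TensorProduct.exists_sum_tmul_eq u
  simp only [map_sum, LinearMap.sum_apply, semiInner_tmul]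
  rw [Finset.sum_comm]
  exact gram_nonneg φ ξ η

/-- The right action of `A` on the algebraic tensor product. -/
def rightMul (a : A) : (Y ⊗[ℂ] X) →ₗ[ℂ] (Y ⊗[ℂ] X) :=
  TensorProduct.map LinearMap.id (opSMulLM a)

theorem semiInner_rightMul (u v : Y ⊗[ℂ] X) (a : A) :
    semiInner φ u (rightMul a v) = semiInner φ u v * a := by
  induction u with
  | zero => simp
  | add x y hx hy => simp [hx, hy, add_mul]
  | tmul ξ η =>
    induction v with
    | zero => simp
    | add x y hx hy => simp [hx, hy, add_mul]
    | tmul ξ' η' =>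
      rw [rightMul, TensorProduct.map_tmul, semiInner_tmul, semiInner_tmul,
        Adjointable.inner_right, Adjointable.inner_right]
      exact inner_op_smul _ _ _

instance : Norm (PreTensor Y φ) := ⟨fun u => √‖semiInner φ u u‖⟩

theorem norm_sq (u : PreTensor Y φ) : ‖u‖ ^ 2 = ‖semiInner φ u u‖ :=
  Real.sq_sqrt (norm_nonneg _)

theorem norm_semiInner_le' (u v : PreTensor Y φ) : ‖semiInner φ u v‖ ≤ ‖u‖ * ‖v‖ :=
  norm_semiInner_le (fun u v => semiInner φ u v) (fun a u => rightMul a u)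
    (fun _ _ _ => map_add _ _ _) (fun _ _ _ => map_smul _ _ _)
    (semiInner_rightMul φ) (star_semiInner φ) (semiInner_self_nonneg φ) u v

theorem core : SeminormedSpace.Core ℂ (PreTensor Y φ) where
  norm_nonneg _ := Real.sqrt_nonneg _
  norm_smul c u := by
    refine (sq_eq_sq₀ (Real.sqrt_nonneg _) (mul_nonneg (norm_nonneg _) (Real.sqrt_nonneg _))).mp ?_
    change ‖c • u‖ ^ 2 = (‖c‖ * ‖u‖) ^ 2
    rw [mul_pow, norm_sq, norm_sq]
    have : semiInner φ (c • u) (c • u) = c • star c • semiInner φ u u := by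
      change semiInner φ (c • (show Y ⊗[ℂ] X from u)) (c • (show Y ⊗[ℂ] X from u)) = _
      rw [map_smul, LinearMap.map_smulₛₗ]
      rfl
    rw [this, norm_smul, norm_smul, norm_star]
    ring
  norm_triangle u v := by
    refine le_of_sq_le_sq ?_ (add_nonneg (Real.sqrt_nonneg _) (Real.sqrt_nonneg _))
    change ‖u + v‖ ^ 2 ≤ (‖u‖ + ‖v‖) ^ 2
    have : semiInner φ (u + v) (u + v) = semiInner φ u u + semiInner φ u v +
        (semiInner φ v u + semiInner φ v v) := by
      change semiInner φ ((show Y ⊗[ℂ] X from u) + (show Y ⊗[ℂ] X from v))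
        ((show Y ⊗[ℂ] X from u) + (show Y ⊗[ℂ] X from v)) = _
      rw [map_add, map_add, LinearMap.add_apply, LinearMap.add_apply]
      abel
    rw [norm_sq, this]
    calc _ ≤ ‖semiInner φ u u‖ + ‖semiInner φ u v‖ + (‖semiInner φ v u‖ + ‖semiInner φ v v‖) :=
          (norm_add_le _ _).trans (add_le_add (norm_add_le _ _) (norm_add_le _ _))
      _ ≤ ‖u‖ ^ 2 + ‖u‖ * ‖v‖ + (‖v‖ * ‖u‖ + ‖v‖ ^ 2) := by
          rw [norm_sq, norm_sq]
          gcongr <;> exact norm_semiInner_le' φ _ _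
      _ = _ := by ring

instance : SeminormedAddCommGroup (PreTensor Y φ) := .ofCore (core φ)

instance : NormedSpace ℂ (PreTensor Y φ) where
  norm_smul_le c u := ((core φ).norm_smul c u).le

/-- The semi-inner product as a continuous linear map in the second variable. -/
def innerCLM (u : PreTensor Y φ) : PreTensor Y φ →L[ℂ] A :=
  LinearMap.mkContinuous (semiInner φ u : PreTensor Y φ →ₗ[ℂ] A) ‖u‖
    (fun v => norm_semiInner_le' φ u v)

theorem norm_semiInner_rightMul_le (a : A) (u : Y ⊗[ℂ] X) :
    ‖semiInner φ (rightMul a u) (rightMul a u)‖ ≤ ‖a‖ ^ 2 * ‖semiInner φ u u‖ := by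
  rw [semiInner_rightMul, ← star_semiInner, semiInner_rightMul, star_mul, star_semiInner]
  calc _ ≤ ‖star a‖ * ‖semiInner φ u u‖ * ‖a‖ :=
        (norm_mul_le _ _).trans (by gcongr; exact norm_mul_le _ _)
    _ = _ := by rw [norm_star]; ring

/-- The right action by `a` as a continuous linear map. -/
def rightMulCLM (a : A) : PreTensor Y φ →L[ℂ] PreTensor Y φ :=
  LinearMap.mkContinuous (rightMul a : PreTensor Y φ →ₗ[ℂ] PreTensor Y φ) ‖a‖ (fun u => by
    refine le_of_sq_le_sq ?_ (by positivity)
    rw [norm_sq, mul_pow, norm_sq]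
    exact norm_semiInner_rightMul_le φ a u)

theorem continuous_inner :
    Continuous fun p : PreTensor Y φ × PreTensor Y φ => semiInner φ p.1 p.2 := by
  let B : PreTensor Y φ →L⋆[ℂ] PreTensor Y φ →L[ℂ] A := LinearMap.mkContinuous₂
    (semiInner φ : PreTensor Y φ →ₗ⋆[ℂ] PreTensor Y φ →ₗ[ℂ] A) 1
    (fun u v => by rw [one_mul]; exact norm_semiInner_le' φ u v)
  exact (B.continuous.comp continuous_fst).clm_apply continuous_snd

end PreTensor

variable (Y) in
/-- The Hausdorff completion of the algebraic tensor product for the semi-inner product. -/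
abbrev TensorCompletion : Type _ := Completion (PreTensor Y φ)

namespace TensorCompletion

variable {φ}

theorem inner_coe (u v : PreTensor Y φ) :
    inner A (u : TensorCompletion Y φ) (v : TensorCompletion Y φ) = PreTensor.semiInner φ u v :=
  (Completion.isDenseInducing_coe.prodMap Completion.isDenseInducing_coe).extend_eq
    (PreTensor.continuous_inner φ : Continuous (Function.uncurry (inner A))) (u, v)

theorem continuous_inner :
    Continuous (Function.uncurry (inner A (E := TensorCompletion Y φ))) := by
  let inner' : PreTensor Y φ →+ PreTensor Y φ →+ A :=
    { toFun := fun u => (PreTensor.semiInner φ u).toAddMonoidHom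
      map_zero' := by ext v; exact LinearMap.congr_fun (map_zero (PreTensor.semiInner φ)) v
      map_add' := fun u v => by
        ext w; exact LinearMap.congr_fun (map_add (PreTensor.semiInner φ) u v) w }
  have : Continuous fun p : PreTensor Y φ × PreTensor Y φ => inner' p.1 p.2 :=
    PreTensor.continuous_inner φ
  rw [Completion.toInner, inner, Function.uncurry_curry _]
  change Continuous (((Completion.isDenseInducing_toCompl (PreTensor Y φ)).prodMap
    (Completion.isDenseInducing_toCompl (PreTensor Y φ))).extend
      fun p : PreTensor Y φ × PreTensor Y φ => inner' p.1 p.2)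
  exact (Completion.isDenseInducing_toCompl _).extend_Z_bilin
    (Completion.isDenseInducing_toCompl _) this

theorem cont_inner {Z : Type*} [TopologicalSpace Z] {f g : Z → TensorCompletion Y φ}
    (hf : Continuous f) (hg : Continuous g) : Continuous fun z => inner A (f z) (g z) :=
  continuous_inner.comp (hf.prodMk hg :)

instance : SMul Aᵐᵒᵖ (TensorCompletion Y φ) :=
  ⟨fun a u => (PreTensor.rightMulCLM φ a.unop).completion u⟩

theorem op_smul_coe (a : A) (u : PreTensor Y φ) :
    op a • (u : TensorCompletion Y φ) = (PreTensor.rightMulCLM φ a u : PreTensor Y φ) :=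
  ContinuousLinearMap.completion_apply_coe _ _

theorem continuous_op_smul (a : A) : Continuous fun u : TensorCompletion Y φ => op a • u :=
  (PreTensor.rightMulCLM φ a).completion.continuous

protected theorem inner_add (x y z : TensorCompletion Y φ) :
    inner A x (y + z) = inner A x y + inner A x z := by
  refine Completion.induction_on₃ x y z ?_ ?_
  · have h1 : Continuous fun p : TensorCompletion Y φ × TensorCompletion Y φ × TensorCompletion Y φ =>
        inner A p.1 (p.2.1 + p.2.2) := cont_inner (by fun_prop) (by fun_prop)
    have h2 : Continuous fun p : TensorCompletion Y φ × TensorCompletion Y φ × TensorCompletion Y φ =>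
        inner A p.1 p.2.1 := cont_inner (by fun_prop) (by fun_prop)
    have h3 : Continuous fun p : TensorCompletion Y φ × TensorCompletion Y φ × TensorCompletion Y φ =>
        inner A p.1 p.2.2 := cont_inner (by fun_prop) (by fun_prop)
    exact isClosed_eq h1 (h2.add h3)
  · intro u v w
    rw [← Completion.coe_add, inner_coe, inner_coe, inner_coe]
    exact map_add (PreTensor.semiInner φ u) v w

protected theorem inner_smul (x y : TensorCompletion Y φ) (c : ℂ) :
    inner A x (c • y) = c • inner A x y := by
  have hc : Continuous fun y : TensorCompletion Y φ => c • y := continuous_const_smul c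
  have h1 : Continuous fun p : TensorCompletion Y φ × TensorCompletion Y φ =>
      inner A p.1 (c • p.2) := cont_inner continuous_fst (hc.comp continuous_snd)
  have h2 : Continuous fun p : TensorCompletion Y φ × TensorCompletion Y φ =>
      c • inner A p.1 p.2 := (cont_inner continuous_fst continuous_snd).const_smul c
  refine Completion.induction_on₂ x y (isClosed_eq h1 h2) ?_
  intro u v
  rw [← Completion.coe_smul, inner_coe, inner_coe]
  exact map_smul (PreTensor.semiInner φ u) c v

protected theorem inner_op_smul (x y : TensorCompletion Y φ) (a : A) :
    inner A x (op a • y) = inner A x y * a := by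
  refine Completion.induction_on₂ x y ?_ ?_
  · have h1 : Continuous fun p : TensorCompletion Y φ × TensorCompletion Y φ =>
        inner A p.1 (op a • p.2) :=
      cont_inner continuous_fst ((continuous_op_smul a).comp continuous_snd)
    have h2 : Continuous fun p : TensorCompletion Y φ × TensorCompletion Y φ =>
        inner A p.1 p.2 := cont_inner (by fun_prop) (by fun_prop)
    exact isClosed_eq h1 (h2.mul_const a)
  · intro u v
    rw [op_smul_coe, inner_coe, inner_coe]
    exact PreTensor.semiInner_rightMul φ u v a

protected theorem star_inner (x y : TensorCompletion Y φ) :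
    star (inner A x y) = inner A y x := by
  refine Completion.induction_on₂ x y ?_ ?_
  · have h1 : Continuous fun p : TensorCompletion Y φ × TensorCompletion Y φ =>
        inner A p.1 p.2 := cont_inner (by fun_prop) (by fun_prop)
    have h2 : Continuous fun p : TensorCompletion Y φ × TensorCompletion Y φ =>
        inner A p.2 p.1 := cont_inner (by fun_prop) (by fun_prop)
    exact isClosed_eq (continuous_star.comp h1) h2
  · intro u v
    rw [inner_coe, inner_coe]
    exact PreTensor.star_semiInner φ u v

protected theorem self_nonneg (x : TensorCompletion Y φ) :
    0 ≤ inner A x x := by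
  induction x using Completion.induction_on with
  | hp => exact isClosed_le continuous_const (cont_inner continuous_id continuous_id)
  | ih u =>
    rw [inner_coe]
    exact PreTensor.semiInner_self_nonneg φ u

protected theorem norm_sq_eq (x : TensorCompletion Y φ) :
    ‖x‖ ^ 2 = ‖inner A x x‖ := by
  induction x using Completion.induction_on with
  | hp => exact isClosed_eq (by fun_prop) (cont_inner continuous_id continuous_id).norm
  | ih u =>
    rw [inner_coe, Completion.norm_coe]
    exact PreTensor.norm_sq φ u

instance : HilbertModule A (TensorCompletion Y φ) where
  inner_add := TensorCompletion.inner_add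
  inner_smul := TensorCompletion.inner_smul
  inner_op_smul := TensorCompletion.inner_op_smul
  star_inner := TensorCompletion.star_inner
  self_nonneg := TensorCompletion.self_nonneg
  norm_sq_eq := TensorCompletion.norm_sq_eq

end TensorCompletion

variable (Y) in
/-- The (interior, balanced) tensor product `Y ⊗_φ X`: the Hausdorff completion of the
algebraic tensor product for the semi-inner product. -/
def BalancedTensor : Type _ := TensorCompletion Y φ

namespace BalancedTensor

instance : NormedAddCommGroup (BalancedTensor Y φ) :=
  inferInstanceAs (NormedAddCommGroup (TensorCompletion Y φ))
instance : NormedSpace ℂ (BalancedTensor Y φ) :=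
  inferInstanceAs (NormedSpace ℂ (TensorCompletion Y φ))
instance : CompleteSpace (BalancedTensor Y φ) :=
  inferInstanceAs (CompleteSpace (TensorCompletion Y φ))
instance : HilbertModule A (BalancedTensor Y φ) :=
  inferInstanceAs (HilbertModule A (TensorCompletion Y φ))

/-- The elementary tensor `ξ ⊗ η` in `Y ⊗_φ X`. -/
def tmul (ξ : Y) (η : X) : BalancedTensor Y φ :=
  ((show PreTensor Y φ from ξ ⊗ₜ[ℂ] η) : TensorCompletion Y φ)

theorem inner_tmul (ξ ξ' : Y) (η η' : X) :
    inner A (tmul φ ξ η) (tmul φ ξ' η') = inner A η ((φ (inner A ξ ξ')).1 η') :=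
  TensorCompletion.inner_coe _ _

variable {φ}

/-- Continuous linear maps out of `Y ⊗_φ X` agreeing on elementary tensors are equal. -/
theorem clm_ext {Z : Type*} [NormedAddCommGroup Z] [NormedSpace ℂ Z]
    {f g : BalancedTensor Y φ →L[ℂ] Z} (h : ∀ ξ η, f (tmul φ ξ η) = g (tmul φ ξ η)) : f = g := by
  refine ContinuousLinearMap.ext fun x => ?_
  refine Completion.induction_on (α := PreTensor Y φ) x
    (isClosed_eq f.continuous g.continuous) fun u => ?_
  have : (f.toLinearMap.comp (Completion.toComplL (𝕜 := ℂ) (E := PreTensor Y φ)).toLinearMap :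
      Y ⊗[ℂ] X →ₗ[ℂ] Z) =
      g.toLinearMap.comp (Completion.toComplL (𝕜 := ℂ) (E := PreTensor Y φ)).toLinearMap :=
    TensorProduct.ext' h
  exact LinearMap.congr_fun this u

theorem inner_ext {x y : BalancedTensor Y φ}
    (h : ∀ ξ η, inner A x (tmul φ ξ η) = inner A y (tmul φ ξ η)) : x = y := by
  have : HilbertModule.innerCLM A x = HilbertModule.innerCLM A y := clm_ext h
  refine eq_of_inner (A := A) fun z => ?_
  rw [← star_inner (A := A) x, ← star_inner (A := A) y]
  exact congrArg star (DFunLike.congr_fun this z)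

theorem tmul_add (ξ : Y) (η η' : X) : tmul φ ξ (η + η') = tmul φ ξ η + tmul φ ξ η' :=
  inner_ext fun _ _ => by simp only [add_inner, inner_tmul]

theorem add_tmul (ξ ξ' : Y) (η : X) : tmul φ (ξ + ξ') η = tmul φ ξ η + tmul φ ξ' η :=
  inner_ext fun _ _ => by
    simp only [add_inner, inner_tmul, map_add, Subalgebra.coe_add, add_apply, inner_add]

theorem smul_tmul (c : ℂ) (ξ : Y) (η : X) : tmul φ (c • ξ) η = c • tmul φ ξ η :=
  inner_ext fun _ _ => by
    simp only [smul_inner, inner_tmul, map_smul, SetLike.val_smul, smul_apply, inner_smul]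

/-- The tensor product is balanced over `A`. -/
theorem op_smul_tmul (a : A) (ξ : Y) (η : X) :
    tmul φ (op a • ξ) η = tmul φ ξ ((φ a).1 η) :=
  inner_ext fun _ _ => by
    rw [inner_tmul, inner_tmul, op_smul_inner, map_mul, Adjointable.inner_left, map_star]
    rfl

theorem op_smul_tmul_right (a : A) (ξ : Y) (η : X) :
    op a • tmul φ ξ η = tmul φ ξ (op a • η) :=
  inner_ext fun _ _ => by
    rw [inner_tmul, op_smul_inner, op_smul_inner, inner_tmul]

end BalancedTensor
end Tensor
end

noncomputable section
open MulOpposite UniformSpace HilbertModule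
open scoped TensorProduct

section Ampl

variable {A : Type*} [NonUnitalCStarAlgebra A] [PartialOrder A] [StarOrderedRing A]
variable {X : Type*} [NormedAddCommGroup X] [NormedSpace ℂ X] [HilbertModule A X] [CompleteSpace X]
variable {Y : Type*} [NormedAddCommGroup Y] [NormedSpace ℂ Y] [HilbertModule A Y] [CompleteSpace Y]
variable (φ : A →⋆ₙₐ[ℂ] Adjointable A X)

theorem Adjointable.exists_norm_sq_sub (S : Adjointable A Y) :
    ∃ R : Adjointable A Y, algebraMap ℝ _ (‖S‖ ^ 2) - star S * S = star R * R := by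
  let _ := CStarAlgebra.spectralOrder (Adjointable A Y)
  have := CStarAlgebra.spectralOrderedRing (Adjointable A Y)
  exact exists_eq_star_mul_self (sub_nonneg.mpr CStarAlgebra.star_mul_le_algebraMap_norm_sq)

namespace PreTensor

/-- The operator `S ⊗ 1` on the algebraic tensor product. -/
def tensorOne (S : Adjointable A Y) : (Y ⊗[ℂ] X) →ₗ[ℂ] (Y ⊗[ℂ] X) :=
  TensorProduct.map (S.1 : Y →ₗ[ℂ] Y) LinearMap.id

theorem semiInner_tensorOne (S : Adjointable A Y) (u v : Y ⊗[ℂ] X) :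
    semiInner φ (tensorOne S u) v = semiInner φ u (tensorOne (star S) v) := by
  induction u with
  | zero => simp
  | add x y hx hy => simp [hx, hy]
  | tmul ξ η =>
    induction v with
    | zero => simp
    | add x y hx hy => simp [hx, hy]
    | tmul ξ' η' =>
      rw [tensorOne, tensorOne, TensorProduct.map_tmul, TensorProduct.map_tmul, semiInner_tmul,
        semiInner_tmul]
      change inner A η ((φ (inner A (S.1 ξ) ξ')).1 η') = _
      rw [Adjointable.inner_left]
      rfl

theorem tensorOne_mul (S T : Adjointable A Y) (u : Y ⊗[ℂ] X) :
    tensorOne (S * T) u = tensorOne S (tensorOne T u) := by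
  induction u with
  | zero => simp
  | add x y hx hy => simp only [map_add, hx, hy]
  | tmul ξ η => rfl

theorem norm_semiInner_tensorOne_le (S : Adjointable A Y) (u : Y ⊗[ℂ] X) :
    ‖semiInner φ (tensorOne S u) (tensorOne S u)‖ ≤ ‖S‖ ^ 2 * ‖semiInner φ u u‖ := by
  obtain ⟨R, hR⟩ := Adjointable.exists_norm_sq_sub S
  have e : ∀ u : Y ⊗[ℂ] X, tensorOne (star R * R) u + tensorOne (star S * S) u =
      ((‖S‖ ^ 2 : ℝ) : ℂ) • u := fun u => by
    induction u with
    | zero => simp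
    | add x y hx hy =>
      rw [map_add, map_add, smul_add, ← hx, ← hy]; abel
    | tmul ξ η =>
      simp only [tensorOne, TensorProduct.map_tmul]
      rw [← TensorProduct.add_tmul, TensorProduct.smul_tmul']
      congr 1
      change ((star R * R).1 + (star S * S).1) ξ = _
      rw [← Subalgebra.coe_add, ← hR, sub_add_cancel, Algebra.algebraMap_eq_smul_one, Complex.coe_smul]
      rfl
  have h1 : semiInner φ (tensorOne R u) (tensorOne R u) +
      semiInner φ (tensorOne S u) (tensorOne S u) = (‖S‖ ^ 2) • semiInner φ u u := by
    rw [semiInner_tensorOne, semiInner_tensorOne, ← tensorOne_mul, ← tensorOne_mul, ← map_add, e,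
      map_smul, Complex.coe_smul]
  have h2 : semiInner φ (tensorOne S u) (tensorOne S u) ≤ (‖S‖ ^ 2) • semiInner φ u u := by
    rw [← h1]
    exact le_add_of_nonneg_left (semiInner_self_nonneg φ _)
  have h3 := CStarAlgebra.norm_le_norm_of_nonneg_of_le (semiInner_self_nonneg φ _) h2
  rwa [norm_smul, Real.norm_of_nonneg (by positivity)] at h3

/-- The operator `S ⊗ 1` as a continuous linear map. -/
def tensorOneCLM (S : Adjointable A Y) : PreTensor Y φ →L[ℂ] PreTensor Y φ :=
  LinearMap.mkContinuous (tensorOne S : PreTensor Y φ →ₗ[ℂ] PreTensor Y φ) ‖S‖ (fun u => by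
    refine le_of_sq_le_sq ?_ (by positivity)
    rw [norm_sq, mul_pow, norm_sq]
    exact norm_semiInner_tensorOne_le φ S u)

end PreTensor

namespace BalancedTensor

/-- The operator `S ⊗ 1` on the completion. -/
def tensorOneCLM (S : Adjointable A Y) : BalancedTensor Y φ →L[ℂ] BalancedTensor Y φ :=
  (PreTensor.tensorOneCLM φ S).completion

theorem tensorOneCLM_tmul (S : Adjointable A Y) (ξ : Y) (η : X) :
    tensorOneCLM φ S (tmul φ ξ η) = tmul φ (S.1 ξ) η :=
  (PreTensor.tensorOneCLM φ S).completion_apply_coe _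

theorem inner_tensorOneCLM (S : Adjointable A Y) (x y : BalancedTensor Y φ) :
    inner A (tensorOneCLM φ S x) y = inner A x (tensorOneCLM φ (star S) y) := by
  have h1 : Continuous fun p : TensorCompletion Y φ × TensorCompletion Y φ =>
      inner A ((PreTensor.tensorOneCLM φ S).completion p.1) p.2 :=
    TensorCompletion.cont_inner
      ((PreTensor.tensorOneCLM φ S).completion.continuous.comp continuous_fst) continuous_snd
  have h2 : Continuous fun p : TensorCompletion Y φ × TensorCompletion Y φ =>
      inner A p.1 ((PreTensor.tensorOneCLM φ (star S)).completion p.2) :=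
    TensorCompletion.cont_inner continuous_fst
      ((PreTensor.tensorOneCLM φ (star S)).completion.continuous.comp continuous_snd)
  refine Completion.induction_on₂ (α := PreTensor Y φ) (β := PreTensor Y φ) x y
    (isClosed_eq h1 h2) fun u v => ?_
  change inner A ((PreTensor.tensorOneCLM φ S).completion (u : TensorCompletion Y φ))
    (v : TensorCompletion Y φ) = inner A (u : TensorCompletion Y φ)
      ((PreTensor.tensorOneCLM φ (star S)).completion (v : TensorCompletion Y φ))
  rw [ContinuousLinearMap.completion_apply_coe, ContinuousLinearMap.completion_apply_coe,
    TensorCompletion.inner_coe, TensorCompletion.inner_coe]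
  exact PreTensor.semiInner_tensorOne φ S u v

/-- The *-homomorphism `S ↦ S ⊗ 1` from `𝓛(Y)` to `𝓛(Y ⊗_φ X)`. -/
def tensorOne : Adjointable A Y →⋆ₙₐ[ℂ] Adjointable A (BalancedTensor Y φ) where
  toFun S := Adjointable.mk (tensorOneCLM φ S) (tensorOneCLM φ (star S)) (inner_tensorOneCLM φ S)
  map_smul' c S := Subtype.ext <| clm_ext fun ξ η =>
    (tensorOneCLM_tmul φ (c • S) ξ η).trans <|
      (smul_tmul c _ η).trans (congrArg (c • ·) (tensorOneCLM_tmul φ S ξ η).symm)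
  map_zero' := Subtype.ext <| clm_ext fun ξ η =>
    (tensorOneCLM_tmul φ 0 ξ η).trans <|
      (congrArg (tmul φ · η) (zero_smul ℂ ξ).symm).trans
        ((smul_tmul 0 ξ η).trans (zero_smul ℂ _))
  map_add' S T := Subtype.ext <| clm_ext fun ξ η =>
    (tensorOneCLM_tmul φ (S + T) ξ η).trans <| (add_tmul _ _ η).trans <|
      congrArg₂ (· + ·) (tensorOneCLM_tmul φ S ξ η).symm (tensorOneCLM_tmul φ T ξ η).symm
  map_mul' S T := Subtype.ext <| clm_ext fun ξ η =>
    (tensorOneCLM_tmul φ (S * T) ξ η).trans <|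
      (tensorOneCLM_tmul φ S (T.1 ξ) η).symm.trans
        (congrArg (tensorOneCLM φ S) (tensorOneCLM_tmul φ T ξ η).symm)
  map_star' S := by
    symm
    apply Adjointable.star_eq
    exact inner_tensorOneCLM φ S

theorem tensorOne_tmul (S : Adjointable A Y) (ξ : Y) (η : X) :
    (tensorOne φ S).1 (tmul φ ξ η) = tmul φ (S.1 ξ) η := tensorOneCLM_tmul φ S ξ η

end BalancedTensor
end Ampl
end

noncomputable section
open MulOpposite UniformSpace HilbertModule
open scoped TensorProduct

section Compacts

variable {A : Type*} [NonUnitalCStarAlgebra A] [PartialOrder A] [StarOrderedRing A]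
variable {Y : Type*} [NormedAddCommGroup Y] [NormedSpace ℂ Y] [HilbertModule A Y]

/-- The underlying continuous linear map of the rank-one operator `z ↦ x ⟨y, z⟩`. -/
def thetaCLM (x y : Y) : Y →L[ℂ] Y :=
  LinearMap.mkContinuous
    { toFun := fun z => op (inner A y z) • x
      map_add' := fun z w => eq_of_inner (A := A) fun v => by
        simp only [inner_add, inner_op_smul, mul_add]
      map_smul' := fun c z => eq_of_inner (A := A) fun v => by
        simp only [inner_smul, inner_op_smul, mul_smul_comm, RingHom.id_apply] }
    (‖x‖ * ‖y‖) fun z => (norm_op_smul_le _ _).trans <| by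
      rw [mul_assoc]; gcongr; exact norm_inner_le _ _

variable (A) in
/-- The rank-one operator `θ_{x,y}(z) = x ⟨y, z⟩`. -/
def theta (x y : Y) : Adjointable A Y :=
  Adjointable.mk (thetaCLM (A := A) x y) (thetaCLM (A := A) y x) fun z w => by
    change inner A (op (inner A y z) • x) w = inner A z (op (inner A x w) • y)
    rw [op_smul_inner, inner_op_smul, star_inner]

@[simp] theorem theta_apply (x y z : Y) : (theta A x y).1 z = op (inner A y z) • x := rfl

@[simp] theorem star_theta (x y : Y) : star (theta A x y) = theta A y x :=
  Adjointable.star_eq fun z w => by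
    rw [theta_apply, theta_apply, op_smul_inner, inner_op_smul, star_inner]

variable (A Y) in
/-- `𝓚(Y)`: the closed linear span of the rank-one operators in `𝓛(Y)`. -/
def compacts : Submodule ℂ (Adjointable A Y) :=
  (Submodule.span ℂ {T | ∃ x y : Y, T = theta A x y}).topologicalClosure

theorem theta_mem (x y : Y) : theta A x y ∈ compacts A Y :=
  Submodule.le_topologicalClosure _ (Submodule.subset_span ⟨x, y, rfl⟩)

theorem compacts_induction {p : Adjointable A Y → Prop} (hc : IsClosed {T | p T})
    (h0 : p 0) (hθ : ∀ x y, p (theta A x y)) (hadd : ∀ S T, p S → p T → p (S + T))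
    (hsmul : ∀ (c : ℂ) T, p T → p (c • T)) {T : Adjointable A Y} (hT : T ∈ compacts A Y) : p T := by
  have : (Submodule.span ℂ {T | ∃ x y : Y, T = theta A x y} : Set (Adjointable A Y)) ⊆
      {T | p T} := fun T hT => by
    refine Submodule.span_induction (p := fun T _ => p T) ?_ h0
      (fun S T _ _ => hadd S T) (fun c T _ => hsmul c T) hT
    rintro _ ⟨x, y, rfl⟩
    exact hθ x y
  exact closure_minimal this hc hT

theorem mul_theta (T : Adjointable A Y) (x y : Y) : T * theta A x y = theta A (T.1 x) y :=
  Adjointable.ext_inner fun v w => by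
    change inner A v (T.1 (op (inner A y w) • x)) = inner A v (op (inner A y w) • (T.1 x))
    rw [Adjointable.inner_right, inner_op_smul, inner_op_smul, Adjointable.inner_right]

theorem mul_mem_compacts (T : Adjointable A Y) {S : Adjointable A Y} (hS : S ∈ compacts A Y) :
    T * S ∈ compacts A Y := by
  refine compacts_induction (p := fun S => T * S ∈ compacts A Y) ?_ ?_ ?_ ?_ ?_ hS
  · exact (Submodule.isClosed_topologicalClosure _).preimage (continuous_const_mul T)
  · simp
  · intro x y; rw [mul_theta]; exact theta_mem _ _
  · intro S S' h h'; rw [mul_add]; exact add_mem h h'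
  · intro c S h; rw [mul_smul_comm]; exact Submodule.smul_mem _ _ h

theorem star_mem_compacts {S : Adjointable A Y} (hS : S ∈ compacts A Y) :
    star S ∈ compacts A Y := by
  refine compacts_induction (p := fun S => star S ∈ compacts A Y) ?_ ?_ ?_ ?_ ?_ hS
  · exact (Submodule.isClosed_topologicalClosure _).preimage continuous_star
  · simp
  · intro x y; rw [star_theta]; exact theta_mem _ _
  · intro S S' h h'; rw [star_add]; exact add_mem h h'
  · intro c S h; rw [star_smul]; exact Submodule.smul_mem _ _ h

theorem mul_mem_compacts' {S : Adjointable A Y} (hS : S ∈ compacts A Y) (T : Adjointable A Y) :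
    S * T ∈ compacts A Y := by
  rw [← star_star (S * T), star_mul]
  exact star_mem_compacts (mul_mem_compacts _ (star_mem_compacts hS))

end Compacts

section Rep

variable {A : Type*} [NonUnitalCStarAlgebra A] [PartialOrder A] [StarOrderedRing A]
variable {X : Type*} [NormedAddCommGroup X] [NormedSpace ℂ X] [HilbertModule A X] [CompleteSpace X]
variable {Y : Type*} [NormedAddCommGroup Y] [NormedSpace ℂ Y] [HilbertModule A Y] [CompleteSpace Y]
variable {B : Type*} [NonUnitalCStarAlgebra B]

/-- A linear map `f : Y → B` with `f(x)^* f(y) = π(⟨x, y⟩)`. -/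
structure ModuleRep (π : A →⋆ₙₐ[ℂ] B) (Y : Type*) [NormedAddCommGroup Y] [NormedSpace ℂ Y]
    [HilbertModule A Y] where
  toLM : Y →ₗ[ℂ] B
  star_mul_map (x y : Y) : star (toLM x) * toLM y = π (inner A x y)

namespace ModuleRep

variable {π : A →⋆ₙₐ[ℂ] B} (f : ModuleRep π Y)

theorem map_op_smul (x : Y) (a : A) : f.toLM (op a • x) = f.toLM x * π a := by
  rw [← sub_eq_zero, ← CStarRing.star_mul_self_eq_zero_iff]
  simp only [star_sub, star_mul, sub_mul, mul_sub, f.star_mul_map]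
  rw [← mul_assoc, f.star_mul_map, mul_assoc (star (π a)), f.star_mul_map, mul_assoc (star (π a)),
    ← mul_assoc (star (f.toLM x)), f.star_mul_map]
  simp only [inner_op_smul, op_smul_inner, map_mul, map_star, mul_assoc, sub_self]

theorem continuous_toLM : Continuous f.toLM :=
  AddMonoidHomClass.continuous_of_bound f.toLM 1 fun x => by
    refine le_of_sq_le_sq ?_ (by positivity)
    rw [one_mul, norm_sq_eq (A := A) x, sq, ← CStarRing.norm_star_mul_self, f.star_mul_map]
    exact NonUnitalStarAlgHom.norm_apply_le _ _

theorem exists_graph : ∃ G : NonUnitalStarSubalgebra ℂ (Adjointable A Y × B),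
    IsClosed (G : Set (Adjointable A Y × B)) ∧
    (∀ x y, (theta A x y, f.toLM x * star (f.toLM y)) ∈ G) ∧
    ∀ b : B, (0, b) ∈ G → b = 0 := by
  let s : Set (Adjointable A Y × B) :=
    {p | ∃ x y, p = (theta A x y, f.toLM x * star (f.toLM y))}
  let Good : Adjointable A Y × B → Prop := fun p =>
    (∀ z, p.2 * f.toLM z = f.toLM (p.1.1 z)) ∧ ∀ c, (∀ z, c * f.toLM z = 0) → c * p.2 = 0
  have hclosed : IsClosed {p | Good p} := by
    have h1 : IsClosed {p : Adjointable A Y × B | ∀ z, p.2 * f.toLM z = f.toLM (p.1.1 z)} := by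
      simp only [Set.ofPred_forall]
      refine isClosed_iInter fun z => isClosed_eq (continuous_snd.mul continuous_const) ?_
      exact f.continuous_toLM.comp ((ContinuousLinearMap.apply ℂ Y z).continuous.comp
        (continuous_subtype_val.comp continuous_fst))
    have h2 : IsClosed {p : Adjointable A Y × B |
        ∀ c, (∀ z, c * f.toLM z = 0) → c * p.2 = 0} := by
      simp only [Set.ofPred_forall]
      exact isClosed_iInter fun c => isClosed_iInter fun _ =>
        isClosed_eq (continuous_const.mul continuous_snd) continuous_const
    exact h1.inter h2
  have hadj : ∀ p ∈ NonUnitalStarAlgebra.adjoin ℂ s, Good p ∧ Good (star p) := by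
    intro p hp
    induction hp using NonUnitalStarAlgebra.adjoin_induction with
    | mem p hp =>
      obtain ⟨x, y, rfl⟩ := hp
      have key : ∀ x y, Good (theta A x y, f.toLM x * star (f.toLM y)) := fun x y =>
        ⟨fun z => by
          change f.toLM x * star (f.toLM y) * f.toLM z = f.toLM (op (inner A y z) • x)
          rw [mul_assoc, f.star_mul_map, f.map_op_smul],
        fun c hc => by
          change c * (f.toLM x * star (f.toLM y)) = 0
          rw [← mul_assoc, hc, zero_mul]⟩
      refine ⟨key x y, ?_⟩
      convert key y x using 1
      rw [Prod.star_def]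
      simp
    | add p q _ _ hp hq =>
      have key : ∀ p q, Good p → Good q → Good (p + q) := fun p q hp hq =>
        ⟨fun z => by
          change (p.2 + q.2) * f.toLM z = f.toLM (p.1.1 z + q.1.1 z)
          rw [add_mul, hp.1, hq.1, map_add],
        fun c hc => by
          change c * (p.2 + q.2) = 0
          rw [mul_add, hp.2 c hc, hq.2 c hc, add_zero]⟩
      exact ⟨key _ _ hp.1 hq.1, by rw [star_add]; exact key _ _ hp.2 hq.2⟩
    | zero =>
      have key : Good 0 := ⟨fun z => by
        change (0 : B) * f.toLM z = f.toLM 0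
        rw [zero_mul, map_zero], fun c _ => mul_zero c⟩
      exact ⟨key, by rw [star_zero]; exact key⟩
    | mul p q _ _ hp hq =>
      have key : ∀ p q, Good p → Good q → Good (p * q) := fun p q hp hq =>
        ⟨fun z => by
          change (p.2 * q.2) * f.toLM z = f.toLM (p.1.1 (q.1.1 z))
          rw [mul_assoc, hq.1, hp.1],
        fun c hc => by
          change c * (p.2 * q.2) = 0
          rw [← mul_assoc, hp.2 c hc, zero_mul]⟩
      exact ⟨key _ _ hp.1 hq.1, by rw [star_mul]; exact key _ _ hq.2 hp.2⟩
    | smul r p _ hp =>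
      have key : ∀ (r : ℂ) p, Good p → Good (r • p) := fun r p hp =>
        ⟨fun z => by
          change (r • p.2) * f.toLM z = f.toLM (r • p.1.1 z)
          rw [smul_mul_assoc, hp.1, map_smul],
        fun c hc => by
          change c * (r • p.2) = 0
          rw [mul_smul_comm, hp.2 c hc, smul_zero]⟩
      exact ⟨key _ _ hp.1, by rw [star_smul]; exact key _ _ hp.2⟩
    | star p _ hp => exact ⟨hp.2, by rw [star_star]; exact hp.1⟩
  have hG : ∀ p ∈ (NonUnitalStarAlgebra.adjoin ℂ s).topologicalClosure, Good p :=
    fun p hp => closure_minimal (fun p hp => (hadj p hp).1) hclosed hp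
  refine ⟨(NonUnitalStarAlgebra.adjoin ℂ s).topologicalClosure, isClosed_closure,
    fun x y => subset_closure (NonUnitalStarAlgebra.subset_adjoin ℂ s ⟨x, y, rfl⟩),
    fun b hb => ?_⟩
  have h1 := (hG _ (star_mem hb)).1
  have h2 := (hG _ hb).2 (star b) fun z => by
    have := h1 z
    simp only [Prod.star_def, star_zero] at this
    rw [this]
    exact map_zero f.toLM
  exact (CStarRing.star_mul_self_eq_zero_iff b).mp h2

set_option maxHeartbeats 2000000 in
/-- There is exactly one continuous linear map `τ : 𝓚(Y) → B` with `τ(θ_{x,y}) = f(x) f(y)^*`. -/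
theorem existsUnique_compactMap :
    ∃! τ : compacts A Y →L[ℂ] B,
      ∀ x y, τ ⟨theta A x y, theta_mem x y⟩ = f.toLM x * star (f.toLM y) := by
  obtain ⟨G, hGc, hGθ, hG0⟩ := f.exists_graph
  have : IsClosed (G : Set (Adjointable A Y × B)) := hGc
  let pr : G →⋆ₙₐ[ℂ] Adjointable A Y :=
    (NonUnitalStarAlgHom.fst ℂ (Adjointable A Y) B).comp (NonUnitalStarSubalgebraClass.subtype G)
  have hpr : ∀ p : G, pr p = p.1.1 := fun _ => rfl
  have hinj : Function.Injective pr := by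
    rw [injective_iff_map_eq_zero]
    rintro ⟨⟨k, b⟩, hp⟩ h
    rw [hpr] at h
    change k = 0 at h
    subst h
    ext1
    exact Prod.ext rfl (hG0 b hp)
  have hiso : Isometry pr := NonUnitalStarAlgHom.isometry pr hinj
  have hnorm : ∀ (T : Adjointable A Y) (b : B), (T, b) ∈ G → ‖b‖ ≤ ‖T‖ := fun T b h => by
    have h1 : ‖T‖ = ‖(T, b)‖ := NonUnitalStarAlgHom.norm_map pr hinj ⟨(T, b), h⟩
    rw [h1]
    exact norm_snd_le (T, b)
  have huniq : ∀ (T : Adjointable A Y) (b b' : B), (T, b) ∈ G → (T, b') ∈ G → b = b' :=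
    fun T b b' h h' => by
      have := sub_mem h h'
      rw [Prod.mk_sub_mk, sub_self] at this
      exact sub_eq_zero.mp (hG0 _ this)
  have hex : ∀ T ∈ compacts A Y, ∃ b, (T, b) ∈ G := by
    intro T hT
    refine compacts_induction (p := fun T => ∃ b, (T, b) ∈ G) ?_ ⟨0, zero_mem G⟩
      (fun x y => ⟨_, hGθ x y⟩) ?_ ?_ hT
    · have : {T | ∃ b, (T, b) ∈ G} = Set.range pr := by
        ext T
        exact ⟨fun ⟨b, h⟩ => ⟨⟨(T, b), h⟩, rfl⟩, fun ⟨p, hp⟩ => ⟨p.1.2, by rw [← hp]; exact p.2⟩⟩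
      rw [this]
      exact hiso.isClosedEmbedding.isClosed_range
    · rintro S T ⟨b, hb⟩ ⟨c, hc⟩
      exact ⟨b + c, add_mem hb hc⟩
    · rintro c T ⟨b, hb⟩
      exact ⟨c • b, SMulMemClass.smul_mem c hb⟩
  choose τ hτ using hex
  refine ⟨LinearMap.mkContinuous
    { toFun := fun T => τ T.1 T.2
      map_add' := fun S T => huniq _ _ _ (hτ _ _) (add_mem (hτ _ S.2) (hτ _ T.2))
      map_smul' := fun c T => huniq _ _ _ (hτ _ _) (SMulMemClass.smul_mem c (hτ _ T.2)) } 1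
    (fun T => by rw [one_mul]; exact hnorm _ _ (hτ _ T.2)),
    fun x y => huniq _ _ _ (hτ _ _) (hGθ x y), fun τ' hτ' => ?_⟩
  ext ⟨T, hT⟩
  set τ₀ : compacts A Y →L[ℂ] B := LinearMap.mkContinuous _ _ _ with hτ₀
  have h0 : ∀ x y, τ₀ ⟨theta A x y, theta_mem x y⟩ = f.toLM x * star (f.toLM y) :=
    fun x y => huniq _ _ _ (hτ _ _) (hGθ x y)
  have : ∃ h : T ∈ compacts A Y, τ' ⟨T, h⟩ = τ₀ ⟨T, h⟩ := by
    refine compacts_induction (p := fun T => ∃ h : T ∈ compacts A Y, τ' ⟨T, h⟩ = τ₀ ⟨T, h⟩)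
      ?_ ⟨zero_mem _, (map_zero τ').trans (map_zero τ₀).symm⟩
      (fun x y => ⟨theta_mem x y, (hτ' x y).trans (h0 x y).symm⟩) ?_ ?_ hT
    · have e : {T | ∃ h : T ∈ compacts A Y, τ' ⟨T, h⟩ = τ₀ ⟨T, h⟩} =
          Subtype.val '' {T : compacts A Y | τ' T = τ₀ T} := by
        ext T
        simp
      rw [e]
      exact (Submodule.isClosed_topologicalClosure _).isClosedEmbedding_subtypeVal.isClosedMap _
        (isClosed_eq τ'.continuous τ₀.continuous)
    · rintro S T ⟨hS, h1⟩ ⟨hT, h2⟩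
      refine ⟨add_mem hS hT, ?_⟩
      exact (map_add τ' ⟨S, hS⟩ ⟨T, hT⟩).trans
        ((congrArg₂ (· + ·) h1 h2).trans (map_add τ₀ ⟨S, hS⟩ ⟨T, hT⟩).symm)
    · rintro c T ⟨hT, h1⟩
      refine ⟨Submodule.smul_mem _ c hT, ?_⟩
      exact (map_smul τ' c ⟨T, hT⟩).trans
        ((congrArg (c • ·) h1).trans (map_smul τ₀ c ⟨T, hT⟩).symm)
  exact this.2

/-- The map `𝓚(Y) → B` determined by `θ_{x,y} ↦ f(x) f(y)^*`. -/
def compactMap : compacts A Y →L[ℂ] B := f.existsUnique_compactMap.choose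

theorem compactMap_theta (x y : Y) :
    f.compactMap ⟨theta A x y, theta_mem x y⟩ = f.toLM x * star (f.toLM y) :=
  f.existsUnique_compactMap.choose_spec.1 x y

end ModuleRep

/-- A representation `(π, t)` of the Hilbert bimodule `X` (with left action `φ`) in `B`: a
`*`-homomorphism `π` and a linear map `t` with `t(ξ)^* t(η) = π(⟨ξ, η⟩)` and
`π(a) t(ξ) = t(φ(a) ξ)`. -/
structure BimoduleRep (φ : A →⋆ₙₐ[ℂ] Adjointable A X) (B : Type*)
    [NonUnitalCStarAlgebra B] where
  π : A →⋆ₙₐ[ℂ] B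
  t : X →ₗ[ℂ] B
  star_mul_map (ξ η : X) : star (t ξ) * t η = π (inner A ξ η)
  map_left (a : A) (ξ : X) : π a * t ξ = t ((φ a).1 ξ)

variable {φ : A →⋆ₙₐ[ℂ] Adjointable A X}

/-- There is a map on `Y ⊗_φ X` with `ξ ⊗ η ↦ f(ξ) t(η)`. -/
theorem ModuleRep.exists_tensor (ψ : BimoduleRep φ B) (f : ModuleRep ψ.π Y) :
    ∃ g : ModuleRep ψ.π (BalancedTensor Y φ),
      ∀ ξ η, g.toLM (BalancedTensor.tmul φ ξ η) = f.toLM ξ * ψ.t η := by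
  let F : Y ⊗[ℂ] X →ₗ[ℂ] B := TensorProduct.lift
    (((LinearMap.mul ℂ B).compl₂ ψ.t).comp f.toLM)
  have hF : ∀ u v, star (F u) * F v = ψ.π (PreTensor.semiInner φ u v) := fun u v => by
    induction u with
    | zero => simp
    | add x y hx hy => simp [hx, hy, add_mul]
    | tmul ξ η =>
      induction v with
      | zero => simp
      | add x y hx hy => simp [hx, hy, mul_add]
      | tmul ξ' η' =>
        change star (f.toLM ξ * ψ.t η) * (f.toLM ξ' * ψ.t η') = _
        rw [PreTensor.semiInner_tmul, star_mul, mul_assoc, ← mul_assoc (star (f.toLM ξ)),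
          f.star_mul_map, ψ.map_left, ψ.star_mul_map]
  have hFn : ∀ u : Y ⊗[ℂ] X, ‖F u‖ ^ 2 ≤ ‖PreTensor.semiInner φ u u‖ := fun u => by
    rw [sq, ← CStarRing.norm_star_mul_self, hF]
    exact NonUnitalStarAlgHom.norm_apply_le _ _
  let G : PreTensor Y φ →L[ℂ] B := LinearMap.mkContinuous (F : PreTensor Y φ →ₗ[ℂ] B) 1 fun u => by
    refine le_of_sq_le_sq ?_ (by positivity)
    rw [one_mul, PreTensor.norm_sq]
    exact hFn u
  let H : TensorCompletion Y φ →L[ℂ] B := G.fromCompletion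
  have hH : ∀ u : PreTensor Y φ, H u = F u := fun u => G.fromCompletion_apply_coe u
  have hcont : Continuous ψ.π :=
    AddMonoidHomClass.continuous_of_bound ψ.π 1 fun a => by
      rw [one_mul]; exact NonUnitalStarAlgHom.norm_apply_le _ _
  refine ⟨⟨(H : TensorCompletion Y φ →ₗ[ℂ] B), fun x y => ?_⟩, fun ξ η => hH _⟩
  have h1 : Continuous fun p : TensorCompletion Y φ × TensorCompletion Y φ =>
      star (H p.1) * H p.2 :=
    (continuous_star.comp (H.continuous.comp continuous_fst)).mul
      (H.continuous.comp continuous_snd)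
  have h2 : Continuous fun p : TensorCompletion Y φ × TensorCompletion Y φ =>
      ψ.π (inner A p.1 p.2) :=
    hcont.comp (TensorCompletion.cont_inner continuous_fst continuous_snd)
  refine Completion.induction_on₂ (α := PreTensor Y φ) (β := PreTensor Y φ) x y
    (isClosed_eq h1 h2) fun u v => ?_
  change star (H u) * H v = ψ.π (inner A (u : TensorCompletion Y φ) (v : TensorCompletion Y φ))
  rw [hH, hH, TensorCompletion.inner_coe]
  exact hF u v

end Rep
end

noncomputable section
open MulOpposite UniformSpace HilbertModule
open scoped TensorProduct

section SelfModule

variable (A : Type*) [NonUnitalCStarAlgebra A] [PartialOrder A] [StarOrderedRing A]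

/-- `A` as a right-Hilbert module over itself: `⟨a, b⟩ = a^* b`, right multiplication. -/
abbrev HilbertModule.self : HilbertModule A A where
  toInner := ⟨fun a b => star a * b⟩
  toSMul := inferInstance
  inner_add x y z := mul_add _ _ _
  inner_smul x y c := mul_smul_comm _ _ _
  inner_op_smul x y a := (mul_assoc _ _ _).symm
  star_inner x y := by
    change star (star x * y) = star y * x
    rw [star_mul, star_star]
  self_nonneg x := star_mul_self_nonneg x
  norm_sq_eq x := by
    change _ = ‖star x * x‖
    rw [CStarRing.norm_star_mul_self, sq]

end SelfModule

/-- A bundled (complete) right-Hilbert `A`-module. -/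
structure HilbertMod (A : Type u) [NonUnitalCStarAlgebra A] [PartialOrder A] where
  carrier : Type u
  [normedAddCommGroup : NormedAddCommGroup carrier]
  [normedSpace : NormedSpace ℂ carrier]
  [completeSpace : CompleteSpace carrier]
  [hilbertModule : HilbertModule A carrier]

namespace HilbertMod

variable {A : Type u} [NonUnitalCStarAlgebra A] [PartialOrder A]

instance : CoeSort (HilbertMod A) (Type u) := ⟨HilbertMod.carrier⟩

attribute [instance] normedAddCommGroup normedSpace completeSpace hilbertModule

end HilbertMod

section Unit

variable (A : Type u) [NonUnitalCStarAlgebra A] [PartialOrder A] [StarOrderedRing A]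

/-- The right-Hilbert module `A` over `A`. -/
def HilbertMod.unit : HilbertMod A where
  carrier := A
  hilbertModule := HilbertModule.self A

/-- The left multiplication `*`-homomorphism `L : A → 𝓛(A)`. -/
def leftMul : A →⋆ₙₐ[ℂ] Adjointable A (HilbertMod.unit A) where
  toFun a := Adjointable.mk (Y := HilbertMod.unit A) (ContinuousLinearMap.mul ℂ A a)
    (ContinuousLinearMap.mul ℂ A (star a)) fun x y => by
      change star (a * (show A from x)) * (show A from y) =
        star (show A from x) * (star a * (show A from y))
      rw [star_mul, mul_assoc]
  map_smul' c a := Subtype.ext (map_smul (ContinuousLinearMap.mul ℂ A) c a)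
  map_zero' := Subtype.ext (map_zero (ContinuousLinearMap.mul ℂ A))
  map_add' a b := Subtype.ext (map_add (ContinuousLinearMap.mul ℂ A) a b)
  map_mul' a b := Subtype.ext <| ContinuousLinearMap.ext fun x => mul_assoc a b (show A from x)
  map_star' a := by
    symm
    apply Adjointable.star_eq
    intro x y
    change star (a * (show A from x)) * (show A from y) =
        star (show A from x) * (star a * (show A from y))
    rw [star_mul, mul_assoc]

variable {A}

theorem leftMul_injective : Function.Injective (leftMul A) := by
  rw [injective_iff_map_eq_zero]
  intro a ha
  have : a * star a = 0 := congrArg (fun T : Adjointable A (HilbertMod.unit A) => T.1 (star a : A)) ha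
  exact (CStarRing.mul_star_self_eq_zero_iff a).mp this

theorem theta_unit (a b : A) : theta A (Y := HilbertMod.unit A) a b = leftMul A (a * star b) :=
  Subtype.ext <| ContinuousLinearMap.ext fun x => (mul_assoc a (star b) (show A from x)).symm

/-- Every compact operator on `A` is left multiplication by exactly one element of `A`. -/
theorem existsUnique_leftMul (S : compacts A (HilbertMod.unit A)) :
    ∃! a : A, leftMul A a = S.1 := by
  obtain ⟨S, hS⟩ := S
  have : ∃ a : A, leftMul A a = S := by
    refine compacts_induction (p := fun S => ∃ a : A, leftMul A a = S) ?_ ⟨0, map_zero _⟩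
      (fun x y => ⟨_, (theta_unit (A := A) x y).symm⟩) ?_ ?_ hS
    · exact (NonUnitalStarAlgHom.isometry (leftMul A)
        leftMul_injective).isClosedEmbedding.isClosed_range
    · rintro S T ⟨a, rfl⟩ ⟨b, rfl⟩
      exact ⟨a + b, map_add _ _ _⟩
    · rintro c T ⟨a, rfl⟩
      exact ⟨c • a, map_smul _ _ _⟩
  obtain ⟨a, ha⟩ := this
  exact ⟨a, ha, fun b hb => leftMul_injective (hb.trans ha.symm)⟩

/-- The element `a` of `A` with `S = L_a`, for `S ∈ 𝓚(A)`. -/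
def ofCompact (S : compacts A (HilbertMod.unit A)) : A := (existsUnique_leftMul S).choose

theorem leftMul_ofCompact (S : compacts A (HilbertMod.unit A)) : leftMul A (ofCompact S) = S.1 :=
  (existsUnique_leftMul S).choose_spec.1

end Unit

section Powers

variable {A X : Type u} [NonUnitalCStarAlgebra A] [PartialOrder A] [StarOrderedRing A]
  [NormedAddCommGroup X] [NormedSpace ℂ X] [CompleteSpace X] [HilbertModule A X]
  (φ : A →⋆ₙₐ[ℂ] Adjointable A X)

/-- The tensor powers `X^{⊗0} = A`, `X^{⊗1} = X`, `X^{⊗(n+2)} = X^{⊗(n+1)} ⊗_φ X`. The factors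
are bracketed to the left; by associativity this is the same as `X ⊗_φ X^{⊗(n+1)}`. -/
def tensorPow : ℕ → HilbertMod A
  | 0 => HilbertMod.unit A
  | 1 => { carrier := X }
  | n + 2 => { carrier := BalancedTensor (tensorPow (n + 1)) φ }

/-- The left action `φ_n : A → 𝓛(X^{⊗n})`: `φ_0 = L`, `φ_1 = φ`, and
`φ_{n+1}(a)` acts by `φ(a)` on the first factor. -/
def leftAction : (n : ℕ) → A →⋆ₙₐ[ℂ] Adjointable A (tensorPow φ n)
  | 0 => leftMul A
  | 1 => φ
  | n + 2 => (BalancedTensor.tensorOne φ).comp (leftAction (n + 1))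

/-- The map `𝓛(X^{⊗(n+1)}) → 𝓛(X^{⊗(n+2)})`, `S ↦ S ⊗ 1`. -/
def tensorOnePow (n : ℕ) :
    Adjointable A (tensorPow φ (n + 1)) →⋆ₙₐ[ℂ] Adjointable A (tensorPow φ (n + 2)) :=
  BalancedTensor.tensorOne φ

/-- For `p ≤ q`, the map `𝓛(X^{⊗(p+1)}) → 𝓛(X^{⊗(q+1)})`, `S ↦ S ⊗ 1_{q-p}`; zero for `p > q`. -/
def amplify (p : ℕ) : (q : ℕ) →
    Adjointable A (tensorPow φ (p + 1)) →⋆ₙₐ[ℂ] Adjointable A (tensorPow φ (q + 1))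
  | 0 => if h : p = 0 then h ▸ NonUnitalStarAlgHom.id ℂ _ else 0
  | q + 1 => if h : p = q + 1 then h ▸ NonUnitalStarAlgHom.id ℂ _
      else (tensorOnePow φ q).comp (amplify p q)

/-- The maps `ι_p^q : 𝓚(X^{⊗p}) → 𝓛(X^{⊗q})`: `ι_0^q(L_a) = φ_q(a)`, `ι_p^q(S) = S ⊗ 1_{q-p}` for
`0 < p ≤ q`; zero for `p > q`. -/
def iota : (p q : ℕ) → compacts A (tensorPow φ p) → Adjointable A (tensorPow φ q)
  | 0, q, S => leftAction φ q (ofCompact S)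
  | _ + 1, 0, _ => 0
  | p + 1, q + 1, S => amplify φ p q S.1

theorem amplify_self (p : ℕ) (S : Adjointable A (tensorPow φ (p + 1))) :
    amplify φ p p S = S := by
  cases p <;> rw [amplify, dif_pos rfl] <;> rfl

theorem amplify_of_le {p q : ℕ} (h : p ≤ q) (S : Adjointable A (tensorPow φ (p + 1))) :
    amplify φ p (q + 1) S = tensorOnePow φ q (amplify φ p q S) := by
  rw [amplify, dif_neg (Nat.lt_succ_of_le h).ne]
  rfl

theorem leftAction_succ (q : ℕ) (a : A) :
    leftAction φ (q + 2) a = tensorOnePow φ q (leftAction φ (q + 1) a) := rfl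

theorem amplify_amplify {p q r : ℕ} (hpq : p ≤ q) (hqr : q ≤ r)
    (S : Adjointable A (tensorPow φ (p + 1))) :
    amplify φ q r (amplify φ p q S) = amplify φ p r S := by
  induction r, hqr using Nat.le_induction with
  | base => rw [amplify_self]
  | succ r hqr ih => rw [amplify_of_le φ hqr, amplify_of_le φ (hpq.trans hqr), ih]

theorem amplify_leftAction {q r : ℕ} (hqr : q ≤ r) (a : A) :
    amplify φ q r (leftAction φ (q + 1) a) = leftAction φ (r + 1) a := by
  induction r, hqr using Nat.le_induction with
  | base => rw [amplify_self]
  | succ r hqr ih => rw [amplify_of_le φ hqr, ih, leftAction_succ]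

theorem iota_zero_left (q : ℕ) (S : compacts A (tensorPow φ 0)) :
    iota φ 0 q S = leftAction φ q (ofCompact S) := by rw [iota]

theorem iota_succ_succ (p q : ℕ) (S : compacts A (tensorPow φ (p + 1))) :
    iota φ (p + 1) (q + 1) S = amplify φ p q S.1 := by rw [iota]

theorem iota_self (p : ℕ) (S : compacts A (tensorPow φ p)) : iota φ p p S = S.1 := by
  cases p with
  | zero => exact (iota_zero_left φ 0 S).trans (leftMul_ofCompact S)
  | succ p => rw [iota_succ_succ, amplify_self]

theorem ofCompact_mul (S T U : compacts A (HilbertMod.unit A)) (h : U.1 = S.1 * T.1) :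
    ofCompact U = ofCompact S * ofCompact T :=
  leftMul_injective <| by
    rw [leftMul_ofCompact, map_mul, leftMul_ofCompact, leftMul_ofCompact, h]

theorem ofCompact_star (S T : compacts A (HilbertMod.unit A)) (h : T.1 = star S.1) :
    ofCompact T = star (ofCompact S) :=
  leftMul_injective <| by
    rw [leftMul_ofCompact, map_star, leftMul_ofCompact, h]

theorem iota_star (p q : ℕ) (S T : compacts A (tensorPow φ p)) (h : T.1 = star S.1) :
    iota φ p q T = star (iota φ p q S) := by
  match p, q with
  | 0, q =>
    rw [iota_zero_left, iota_zero_left, ← map_star]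
    exact congrArg (leftAction φ q) (ofCompact_star S T h)
  | p + 1, 0 => exact (star_zero _).symm
  | p + 1, q + 1 => rw [iota_succ_succ, iota_succ_succ, ← map_star, h]

theorem iota_mul {p q r : ℕ} (hpq : p ≤ q) (hqr : q ≤ r) (S : compacts A (tensorPow φ p))
    (T U : compacts A (tensorPow φ q)) (h : U.1 = iota φ p q S * T.1) :
    iota φ p r S * iota φ q r T = iota φ q r U := by
  match p, q, r, hpq, hqr with
  | 0, 0, r, _, _ =>
    rw [iota_self] at h
    rw [iota_zero_left, iota_zero_left, iota_zero_left, ← map_mul]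
    exact congrArg (leftAction φ r) (ofCompact_mul S T U h).symm
  | 0, q + 1, r + 1, _, hqr =>
    rw [iota_zero_left] at h
    rw [iota_succ_succ, iota_succ_succ, iota_zero_left, h, map_mul,
      amplify_leftAction φ (Nat.le_of_succ_le_succ hqr)]
  | p + 1, q + 1, r + 1, hpq, hqr =>
    rw [iota_succ_succ] at h
    rw [iota_succ_succ, iota_succ_succ, iota_succ_succ, h, map_mul,
      amplify_amplify φ (Nat.le_of_succ_le_succ hpq) (Nat.le_of_succ_le_succ hqr)]

/-- The product system of tensor powers is compactly aligned. -/
theorem iota_mul_mem {m n : ℕ} (S : compacts A (tensorPow φ m)) (T : compacts A (tensorPow φ n)) :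
    iota φ m (m ⊔ n) S * iota φ n (m ⊔ n) T ∈ compacts A (tensorPow φ (m ⊔ n)) := by
  have key : ∀ n r (_ : n = r) (T : compacts A (tensorPow φ n)),
      iota φ n r T ∈ compacts A (tensorPow φ r) := by
    rintro n _ rfl T
    rw [iota_self]
    exact T.2
  rcases le_total m n with h | h
  · exact mul_mem_compacts _ (key _ _ (sup_eq_right.mpr h).symm T)
  · exact mul_mem_compacts' (key _ _ (sup_eq_left.mpr h).symm S) _

/-- The ideal `I_n = ⋂_{0 < m ≤ n} ker φ_m` (with `I_0 = A`). -/
def kerIdeal (n : ℕ) : Set A := {a | ∀ m, 0 < m → m ≤ n → leftAction φ m a = 0}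

section IdealSub

variable {Y : Type*} [NormedAddCommGroup Y] [NormedSpace ℂ Y] [HilbertModule A Y]

theorem map_inner_eq_zero {D : Type*} [NonUnitalCStarAlgebra D] (ρ : A →⋆ₙₐ[ℂ] D) {x : Y}
    (hx : ρ (inner A x x) = 0) (y : Y) : ρ (inner A y x) = 0 := by
  let _ := CStarAlgebra.spectralOrder D
  have := CStarAlgebra.spectralOrderedRing D
  have h1 := semiInner_star_mul_le (inner A : Y → Y → A) (fun a y => op a • y) inner_add
    inner_smul inner_op_smul star_inner self_nonneg y x _ (lt_add_one _)
  have h2 : ρ (star (inner A y x) * inner A y x) ≤ ρ ((‖inner A y y‖ + 1) • inner A x x) :=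
    OrderHomClass.mono ρ h1
  rw [← Complex.coe_smul, map_smul, hx, smul_zero, map_mul, map_star] at h2
  exact (CStarRing.star_mul_self_eq_zero_iff _).mp (le_antisymm h2 (star_mul_self_nonneg _))

theorem inner_mem_kerIdeal {n : ℕ} {x : Y} (hx : inner A x x ∈ kerIdeal φ n) (y : Y) :
    inner A y x ∈ kerIdeal φ n :=
  fun m h0 hm => map_inner_eq_zero (leftAction φ m) (hx m h0 hm) y

theorem inner_mem_kerIdeal' {n : ℕ} {x : Y} (hx : inner A x x ∈ kerIdeal φ n) (y : Y) :
    inner A x y ∈ kerIdeal φ n := fun m h0 hm => by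
  rw [← star_inner, map_star, inner_mem_kerIdeal φ hx y m h0 hm, star_zero]

variable (Y) in
/-- The closed submodule `Y I_n = {ξ ∈ Y | ⟨ξ, ξ⟩ ∈ I_n}` of `Y`. -/
def idealSub (n : ℕ) : Submodule ℂ Y where
  carrier := {x | inner A x x ∈ kerIdeal φ n}
  zero_mem' m _ _ := by rw [inner_zero, map_zero]
  add_mem' := fun {x y} hx hy m h0 hm => by
    rw [inner_add, map_add, inner_mem_kerIdeal φ hx _ m h0 hm,
      inner_mem_kerIdeal φ hy _ m h0 hm, add_zero]
  smul_mem' c x hx m h0 hm := by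
    rw [inner_smul, map_smul, inner_mem_kerIdeal φ hx _ m h0 hm, smul_zero]

theorem isClosed_idealSub (n : ℕ) : IsClosed (idealSub φ Y n : Set Y) := by
  have hin : Continuous fun x : Y => inner A x x := by
    let b : Y →L⋆[ℂ] Y →L[ℂ] A := LinearMap.mkContinuous₂
      (LinearMap.mk₂'ₛₗ (starRingEnd ℂ) (RingHom.id ℂ) (fun x y : Y => inner A x y)
        add_inner (fun c x y => smul_inner x y c) inner_add (fun c x y => inner_smul x y c)) 1
      (fun x y => by rw [one_mul]; exact norm_inner_le x y)
    exact b.continuous.clm_apply continuous_id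
  change IsClosed {x : Y | ∀ m, 0 < m → m ≤ n → leftAction φ m (inner A x x) = 0}
  simp only [Set.ofPred_forall]
  refine isClosed_iInter fun m => isClosed_iInter fun _ => isClosed_iInter fun _ => ?_
  refine isClosed_eq (Continuous.comp ?_ hin) continuous_const
  exact AddMonoidHomClass.continuous_of_bound (leftAction φ m) 1 fun a => by
    rw [one_mul]; exact NonUnitalStarAlgHom.norm_apply_le _ _

instance (n : ℕ) [CompleteSpace Y] : CompleteSpace (idealSub φ Y n) :=
  (isClosed_idealSub φ n).completeSpace_coe

instance (n : ℕ) : HilbertModule A (idealSub φ Y n) where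
  toInner := ⟨fun x y => inner A x.1 y.1⟩
  toSMul := ⟨fun a x => ⟨a • x.1, fun m h0 hm => by
    rw [← op_unop a, inner_op_smul, op_smul_inner, map_mul, map_mul, x.2 m h0 hm, mul_zero,
      zero_mul]⟩⟩
  inner_add x y z := inner_add x.1 y.1 z.1
  inner_smul x y c := inner_smul x.1 y.1 c
  inner_op_smul x y a := inner_op_smul x.1 y.1 a
  star_inner x y := star_inner x.1 y.1
  self_nonneg x := self_nonneg x.1
  norm_sq_eq x := norm_sq_eq x.1

theorem map_mem_idealSub {n : ℕ} (T : Adjointable A Y) {x : Y} (hx : x ∈ idealSub φ Y n) :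
    T.1 x ∈ idealSub φ Y n := fun m h0 hm => by
  rw [Adjointable.inner_right]
  exact inner_mem_kerIdeal φ hx _ m h0 hm

/-- The restriction `T ↦ T|_{Y I_n}`, from `𝓛(Y)` to `𝓛(Y I_n)`. -/
def restrict (n : ℕ) : Adjointable A Y →⋆ₙₐ[ℂ] Adjointable A (idealSub φ Y n) where
  toFun T := Adjointable.mk
    (T.1.restrict fun _ hx => map_mem_idealSub φ T hx)
    ((star T).1.restrict fun _ hx => map_mem_idealSub φ (star T) hx)
    fun x y => Adjointable.inner_left T x.1 y.1
  map_smul' _ _ := rfl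
  map_zero' := rfl
  map_add' _ _ := rfl
  map_mul' _ _ := rfl
  map_star' T := by
    symm
    apply Adjointable.star_eq
    exact fun x y => Adjointable.inner_left T x.1 y.1

theorem restrict_mul (n : ℕ) (S T : Adjointable A Y) :
    restrict φ n (S * T) = restrict φ n S * restrict φ n T := map_mul _ _ _

theorem restrict_star (n : ℕ) (S : Adjointable A Y) :
    restrict φ n (star S) = star (restrict φ n S) := map_star _ _

theorem restrict_apply {n : ℕ} (T : Adjointable A Y) (x : idealSub φ Y n) :
    ((restrict φ n T).1 x : Y) = T.1 x := rfl

end IdealSub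

/-- The operator `ι_p^q(S)|_{X^{⊗q} I_k}`, for `p ≤ q`; zero for `p > q`. -/
def block (k q p : ℕ) (S : compacts A (tensorPow φ p)) :
    Adjointable A (idealSub φ (tensorPow φ q) k) :=
  if p ≤ q then restrict φ k (iota φ p q S) else 0

theorem block_of_le {k q p : ℕ} (h : p ≤ q) (S : compacts A (tensorPow φ p)) :
    block φ k q p S = restrict φ k (iota φ p q S) := if_pos h

theorem block_of_not_le {k q p : ℕ} (h : ¬ p ≤ q) (S : compacts A (tensorPow φ p)) :
    block φ k q p S = 0 := if_neg h

theorem block_star (k q p : ℕ) (S T : compacts A (tensorPow φ p)) (h : T.1 = star S.1) :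
    star (block φ k q p S) = block φ k q p T := by
  by_cases hq : p ≤ q
  · rw [block_of_le φ hq, block_of_le φ hq]
    exact (restrict_star φ k _).symm.trans
      (congrArg (restrict φ k) (iota_star φ p q S T h).symm)
  · rw [block_of_not_le φ hq, block_of_not_le φ hq]
    exact star_zero _

theorem block_mul (k r : ℕ) {p q : ℕ} (hpq : p ≤ q) (S : compacts A (tensorPow φ p))
    (T U : compacts A (tensorPow φ q)) (h : U.1 = iota φ p q S * T.1) :
    block φ k r p S * block φ k r q T = block φ k r q U := by
  by_cases hr : q ≤ r
  · rw [block_of_le φ hr, block_of_le φ hr, block_of_le φ (hpq.trans hr)]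
    exact (restrict_mul φ k _ _).symm.trans
      (congrArg (restrict φ k) (iota_mul φ hpq hr S T U h))
  · rw [block_of_not_le φ hr, block_of_not_le φ hr]
    exact mul_zero _

/-- The C*-algebra `⨁_{0 ≤ q ≤ n} 𝓛(X^{⊗q} I_{n-q})`. -/
def BlockAlgebra (n : ℕ) : Type u :=
  (q : Fin (n + 1)) → Adjointable A (idealSub φ (tensorPow φ q) (n - q))

instance (n : ℕ) : CStarAlgebra (BlockAlgebra φ n) :=
  inferInstanceAs (CStarAlgebra
    ((q : Fin (n + 1)) → Adjointable A (idealSub φ (tensorPow φ q) (n - q))))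

/-- The element `⨁_{p ≤ q ≤ n} ι_p^q(S)|_{X^{⊗q} I_{n-q}}`, with zeros in the places `q < p`. -/
def iotaTilde (n p : ℕ) (S : compacts A (tensorPow φ p)) : BlockAlgebra φ n :=
  fun q => block φ (n - q) q p S

theorem iotaTilde_star (n p : ℕ) (S T : compacts A (tensorPow φ p)) (h : T.1 = star S.1) :
    star (iotaTilde φ n p S) = iotaTilde φ n p T :=
  funext fun q => block_star φ (n - q) q p S T h

theorem iotaTilde_mul (n : ℕ) {p q : ℕ} (hpq : p ≤ q) (S : compacts A (tensorPow φ p))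
    (T U : compacts A (tensorPow φ q)) (h : U.1 = iota φ p q S * T.1) :
    iotaTilde φ n p S * iotaTilde φ n q T = iotaTilde φ n q U :=
  funext fun r => block_mul φ (n - r) r hpq S T U h

/-- The algebra `C_n = span {ι̃_p^n(S) | 0 ≤ p ≤ n, S ∈ 𝓚(X^{⊗p})}`. -/
def blockSubalgebra (n : ℕ) : NonUnitalStarSubalgebra ℂ (BlockAlgebra φ n) where
  toSubmodule := Submodule.span ℂ {x | ∃ p, p ≤ n ∧ ∃ S, x = iotaTilde φ n p S}
  mul_mem' := fun {x y} hx hy => by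
    refine Submodule.span_induction (p := fun x _ => x * y ∈ Submodule.span ℂ _) ?_
      (by rw [zero_mul]; exact zero_mem _)
      (fun x x' _ _ h h' => by rw [add_mul]; exact add_mem h h')
      (fun c x _ h => by rw [smul_mul_assoc]; exact Submodule.smul_mem _ c h) hx
    rintro _ ⟨p, hp, S, rfl⟩
    refine Submodule.span_induction
      (p := fun y _ => iotaTilde φ n p S * y ∈ Submodule.span ℂ _) ?_
      (by rw [mul_zero]; exact zero_mem _)
      (fun x x' _ _ h h' => by rw [mul_add]; exact add_mem h h')
      (fun c x _ h => by rw [mul_smul_comm]; exact Submodule.smul_mem _ c h) hy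
    rintro _ ⟨q, hq, T, rfl⟩
    rcases le_total p q with h | h
    · rw [iotaTilde_mul φ n h S T ⟨_, mul_mem_compacts (iota φ p q S) T.2⟩ rfl]
      exact Submodule.subset_span ⟨q, hq, _, rfl⟩
    · have e := iotaTilde_mul φ n h ⟨_, star_mem_compacts T.2⟩ ⟨_, star_mem_compacts S.2⟩
        ⟨_, mul_mem_compacts (iota φ q p ⟨_, star_mem_compacts T.2⟩) (star_mem_compacts S.2)⟩ rfl
      rw [← iotaTilde_star φ n q T _ rfl, ← iotaTilde_star φ n p S _ rfl, ← star_mul] at e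
      rw [← star_star (iotaTilde φ n p S * iotaTilde φ n q T), e,
        iotaTilde_star φ n p _ ⟨_, star_mem_compacts (Subtype.prop _)⟩ rfl]
      exact Submodule.subset_span ⟨p, hp, _, rfl⟩
  star_mem' := fun {x} hx => by
    refine Submodule.span_induction (p := fun x _ => star x ∈ Submodule.span ℂ _) ?_
      (by rw [star_zero]; exact zero_mem _)
      (fun x x' _ _ h h' => by rw [star_add]; exact add_mem h h')
      (fun c x _ h => by rw [star_smul]; exact Submodule.smul_mem _ _ h) hx
    rintro _ ⟨p, hp, S, rfl⟩
    rw [iotaTilde_star φ n p S ⟨_, star_mem_compacts S.2⟩ rfl]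
    exact Submodule.subset_span ⟨p, hp, _, rfl⟩

theorem iotaTilde_mem {n p : ℕ} (hp : p ≤ n) (S : compacts A (tensorPow φ p)) :
    iotaTilde φ n p S ∈ blockSubalgebra φ n :=
  Submodule.subset_span ⟨p, hp, S, rfl⟩

end Powers
end

noncomputable section
open MulOpposite UniformSpace HilbertModule
open scoped TensorProduct

section Covariance

variable {A X : Type u} [NonUnitalCStarAlgebra A] [PartialOrder A] [StarOrderedRing A]
  [NormedAddCommGroup X] [NormedSpace ℂ X] [CompleteSpace X] [HilbertModule A X]
  {φ : A →⋆ₙₐ[ℂ] Adjointable A X} {B : Type v} [NonUnitalCStarAlgebra B]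

namespace BimoduleRep

variable (ψ : BimoduleRep φ B)

/-- The linear map `t : X → B`. -/
def toModuleRep : ModuleRep ψ.π X where
  toLM := ψ.t
  star_mul_map := ψ.star_mul_map

/-- The maps `t_n : X^{⊗n} → B`: `t_0 = π`, `t_1 = t`, and `t_{n+1}(ξ ⊗ η) = t_n(ξ) t(η)`. -/
def tpow : (n : ℕ) → ModuleRep ψ.π (tensorPow φ n)
  | 0 =>
    { toLM := (ψ.π : A →ₗ[ℂ] B)
      star_mul_map := fun x y =>
        (congrArg (· * ψ.π (show A from y)) (map_star ψ.π (show A from x)).symm).trans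
          (map_mul ψ.π (star (show A from x)) (show A from y)).symm }
  | 1 => ψ.toModuleRep
  | n + 2 => (ModuleRep.exists_tensor ψ (tpow (n + 1))).choose

theorem tpow_zero (a : A) : (ψ.tpow 0).toLM a = ψ.π a := rfl

theorem tpow_one (ξ : X) : (ψ.tpow 1).toLM ξ = ψ.t ξ := rfl

theorem tpow_tmul (n : ℕ) (ξ : tensorPow φ (n + 1)) (η : X) :
    (ψ.tpow (n + 2)).toLM (BalancedTensor.tmul φ ξ η) = (ψ.tpow (n + 1)).toLM ξ * ψ.t η :=
  (ModuleRep.exists_tensor ψ (ψ.tpow (n + 1))).choose_spec ξ η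

/-- The maps `t^{(n)} : 𝓚(X^{⊗n}) → B`, `θ_{ξ,η} ↦ t_n(ξ) t_n(η)^*`. -/
def compactRep (n : ℕ) : compacts A (tensorPow φ n) →L[ℂ] B := (ψ.tpow n).compactMap

/-- The map `t^{(1)}` on `𝓚(X)`. -/
theorem compactRep_one (S : compacts A X) : ψ.compactRep 1 S = ψ.toModuleRep.compactMap S := rfl

theorem compactRep_theta (n : ℕ) (ξ η : tensorPow φ n) :
    ψ.compactRep n ⟨theta A ξ η, theta_mem ξ η⟩ =
      (ψ.tpow n).toLM ξ * star ((ψ.tpow n).toLM η) := (ψ.tpow n).compactMap_theta ξ η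

/-- The core: the closed linear span of `{t_n(ξ) t_n(η)^* | n ∈ ℕ, ξ, η ∈ X^{⊗n}}`. -/
def core : Submodule ℂ B :=
  (Submodule.span ℂ {b | ∃ (n : ℕ) (ξ η : tensorPow φ n),
    b = (ψ.tpow n).toLM ξ * star ((ψ.tpow n).toLM η)}).topologicalClosure

/-- Cuntz–Pimsner covariance: `π(a) = t^{(1)}(φ(a))` for all `a` in Katsura's ideal
`J_X = {a | φ(a) ∈ 𝓚(X) and a b = 0 for all b ∈ ker φ}`. -/
def IsCuntzPimsnerCovariant : Prop :=
  ∀ (a : A) (ha : φ a ∈ compacts A X), (∀ b : A, φ b = 0 → a * b = 0) →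
    ψ.π a = ψ.toModuleRep.compactMap ⟨φ a, ha⟩

/-- The formula `κ_n(∑_{p ≤ n} ι̃_p^n(S_p)) = ∑_{p ≤ n} t^{(p)}(S_p)` gives a well-defined
`*`-homomorphism from `C_n` to the core. -/
def KappaIsStarHom (n : ℕ) : Prop :=
  ∃ κ : blockSubalgebra φ n →⋆ₙₐ[ℂ] B, (∀ x, κ x ∈ ψ.core) ∧
    ∀ S : (p : Fin (n + 1)) → compacts A (tensorPow φ p),
      κ (∑ p : Fin (n + 1), ⟨iotaTilde φ n p (S p), iotaTilde_mem φ (Fin.is_le p) (S p)⟩) =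
        ∑ p : Fin (n + 1), ψ.compactRep p (S p)

/-- Nica covariance: `t^{(m)}(S) t^{(n)}(T) = t^{(m ∨ n)}(ι_m^{m ∨ n}(S) ι_n^{m ∨ n}(T))`. -/
def IsNicaCovariant : Prop :=
  ∀ (m n : ℕ) (S : compacts A (tensorPow φ m)) (T : compacts A (tensorPow φ n)),
    ψ.compactRep m S * ψ.compactRep n T =
      ψ.compactRep (m ⊔ n) ⟨iota φ m (m ⊔ n) S * iota φ n (m ⊔ n) T, iota_mul_mem φ S T⟩

/-- Cuntz–Nica–Pimsner covariance (Sims–Yeend) over `ℕ`: Nica covariance, and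
`∑_{p ∈ F} t^{(p)}(S_p) = 0` whenever `F` is finite and `∑_{p ∈ F} ι̃_p^q(S_p) = 0` for large `q`,
that is, every `n` has some `m ≥ n` such that the equation holds for all `q ≥ m`. -/
def IsCNPCovariant : Prop :=
  ψ.IsNicaCovariant ∧
    ∀ (F : Finset ℕ) (S : (p : ℕ) → compacts A (tensorPow φ p)),
      (∀ n : ℕ, ∃ m, n ≤ m ∧ ∀ q, m ≤ q → ∑ p ∈ F, iotaTilde φ q p (S p) = 0) →
        ∑ p ∈ F, ψ.compactRep p (S p) = 0

end BimoduleRep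
end Covariance
end

noncomputable section
open MulOpposite UniformSpace HilbertModule Filter Topology
open scoped TensorProduct

/-! The heart is the implication, for Katsura-covariant `(π, t)`: if `∑_{p ≤ n} ι̃_p^n(S_p) = 0`,
then `∑_{p ≤ n} t^{(p)}(S_p) = 0` (`sum_compactRep_eq_zero`). Put `R_k = ∑_{p ≤ k} ι_p^k(S_p)`.
Since `I_0 = A` and `I_m = ker φ` for `m ≥ 1`, the hypothesis says that `R_n = 0` and that `R_k`
vanishes on `X_k ker φ` for `k < n`. Moreover `R_{k+1} = R_k ⊗ 1 + S_{k+1}`, where for `k = 0` and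
`R_0 = L_a` the term `R_0 ⊗ 1` is read as `φ(a)`. Descending from `k = n`, one shows that each `R_k`
is compact and that `t^{(k+1)}(R_{k+1}) = t^{(k)}(R_k) + t^{(k+1)}(S_{k+1})`. The sum then
telescopes down to `R_0 = S_0`.

Two facts make a step of the descent work for an operator `T` on `Y` that vanishes on `Y ker φ` and
has `T ⊗ 1` compact. Firstly, `T` is itself compact (`mem_compacts_of_tensorOne`): the pair of
`*`-homomorphisms `T ↦ T|_{Y ker φ}` and `T ↦ T ⊗ 1` is jointly injective, hence isometric, so that
norm convergence of `(S ⊗ 1)(T ⊗ 1)` to `T ⊗ 1` along an approximate unit of `𝓚(Y)` gives `S T → T`.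
Secondly, covariance makes `T` and `T ⊗ 1` have the same image in `B`
(`compactMap_eq_compactMap_tensorOne`): the elements `⟨ξ, T^* T ξ⟩` lie in Katsura's ideal, and
covariance at these elements forces the difference of the two images to vanish.

Granted this, `κ_n` is single-valued, and it is a `*`-homomorphism because the relation that defines
it is closed under the algebra operations. Nica covariance is automatic since `ℕ` is totally
ordered, and the second half of CNP-covariance is the implication above for one large `q`.
Conversely, for `a` in Katsura's ideal the family `(L_a, -φ(a))` has `ι̃`-sum zero for every `q ≥
1`; either of conditions 2 and 3 then yields `π(a) = t^{(1)}(φ(a))`. -/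

theorem isClosed_setOf_tendsto_self {ι E : Type*} [PseudoMetricSpace E] (l : Filter ι)
    (F : ι → E → E) (hF : ∀ᶠ i in l, LipschitzWith 1 (F i)) :
    IsClosed {z | Tendsto (fun i => F i z) l (𝓝 z)} := by
  refine isClosed_of_closure_subset fun z hz => ?_
  refine Metric.tendsto_nhds.mpr fun ε hε => ?_
  obtain ⟨w, hw, hzw⟩ := Metric.mem_closure_iff.mp hz (ε / 3) (by positivity)
  filter_upwards [hF, Metric.tendsto_nhds.mp hw (ε / 3) (by positivity)] with i hi hiw
  -- The Lipschitz bound is uniform in `i`, so `F i z` stays within `ε / 3` of `F i w`, which is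
  -- eventually within `ε / 3` of `w`.
  have h1 := hi.dist_le_mul z w
  rw [NNReal.coe_one, one_mul] at h1
  have h2 := dist_triangle4 (F i z) (F i w) w z
  rw [dist_comm w z] at h2
  linarith

/-! ### Approximate units of `𝓚(Y)` and their strong convergence -/

section Compacts

variable {A : Type*} [NonUnitalCStarAlgebra A] [PartialOrder A] [StarOrderedRing A]
variable {Y : Type*} [NormedAddCommGroup Y] [NormedSpace ℂ Y] [HilbertModule A Y]

/-- A form for predicates that make sense only on `𝓚(Y)`, such as identities involving `compactMap`.
Closedness carries over to `𝓛(Y)` because `𝓚(Y)` is closed there. -/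
theorem compacts_subtype_induction {p : compacts A Y → Prop} (hc : IsClosed {T | p T})
    (h0 : p 0) (hθ : ∀ x y, p ⟨theta A x y, theta_mem x y⟩)
    (hadd : ∀ S T, p S → p T → p (S + T)) (hsmul : ∀ (c : ℂ) T, p T → p (c • T))
    (T : compacts A Y) : p T := by
  have : ∃ h : T.1 ∈ compacts A Y, p ⟨T.1, h⟩ := by
    refine compacts_induction (p := fun T => ∃ h : T ∈ compacts A Y, p ⟨T, h⟩)
      ?_ ⟨zero_mem _, h0⟩ (fun x y => ⟨theta_mem x y, hθ x y⟩) ?_ ?_ T.2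
    · have e : {T | ∃ h : T ∈ compacts A Y, p ⟨T, h⟩} = Subtype.val '' {T : compacts A Y | p T} := by
        ext T
        simp
      rw [e]
      exact (Submodule.isClosed_topologicalClosure _).isClosedEmbedding_subtypeVal.isClosedMap _ hc
    · rintro S T ⟨hS, h1⟩ ⟨hT, h2⟩
      exact ⟨add_mem hS hT, hadd _ _ h1 h2⟩
    · rintro c T ⟨hT, h1⟩
      exact ⟨Submodule.smul_mem _ c hT, hsmul c _ h1⟩
  exact this.2

/-- Pairing `θ_{x,x} x` with `x` gives `⟨x,x⟩^* ⟨x,x⟩`, of norm `‖x‖ ^ 4`. The bound lets operator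
norms control norms of vectors. -/
theorem norm_sq_le_norm_theta_self (x : Y) : ‖x‖ ^ 2 ≤ ‖theta A x x‖ := by
  rcases (norm_nonneg x).eq_or_lt with h | h
  · rw [← h, sq, zero_mul]
    exact norm_nonneg _
  have h1 : inner A x ((theta A x x).1 x) = star (inner A x x) * inner A x x := by
    rw [theta_apply, inner_op_smul, star_inner]
  have h2 : ‖x‖ ^ 2 * ‖x‖ ^ 2 ≤ ‖theta A x x‖ * ‖x‖ ^ 2 := by
    calc _ = ‖inner A x ((theta A x x).1 x)‖ := by
          rw [h1, CStarRing.norm_star_mul_self, ← norm_sq_eq]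
      _ ≤ ‖x‖ * (‖theta A x x‖ * ‖x‖) :=
          (norm_inner_le _ _).trans (by gcongr; exact (theta A x x).1.le_opNorm x)
      _ = _ := by ring
  exact le_of_mul_le_mul_right h2 (by positivity)

theorem theta_mul_eq (x y : Y) (T : Adjointable A Y) :
    theta A x y * T = theta A x ((star T).1 y) := by
  rw [← star_star (theta A x y * T), star_mul, star_theta, mul_theta, star_theta]

variable [CompleteSpace Y]

variable (A Y) in
/-- `𝓚(Y)` as a `*`-subalgebra of `𝓛(Y)`. -/
def compactsSubalgebra : NonUnitalStarSubalgebra ℂ (Adjointable A Y) where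
  toSubmodule := compacts A Y
  mul_mem' := fun {S _} _ hT => mul_mem_compacts S hT
  star_mem' := star_mem_compacts

instance : IsClosed (compactsSubalgebra A Y : Set (Adjointable A Y)) :=
  Submodule.isClosed_topologicalClosure _

variable (A Y) in
-- The approximate unit of the C*-algebra `𝓚(Y)` is pushed forward to `𝓛(Y)`, where its members can
-- be amplified and multiplied by operators that are not known to be compact.
theorem exists_compacts_approximateUnit :
    ∃ l : Filter (Adjointable A Y), l.NeBot ∧ (∀ᶠ S in l, S ∈ compacts A Y ∧ ‖S‖ ≤ 1) ∧
      ∀ T ∈ compacts A Y, Tendsto (fun S => S * T) l (𝓝 T) := by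
  let _ := CStarAlgebra.spectralOrder (compactsSubalgebra A Y)
  have := CStarAlgebra.spectralOrderedRing (compactsSubalgebra A Y)
  have hl := CStarAlgebra.increasingApproximateUnit (compactsSubalgebra A Y)
  have := hl.neBot
  refine ⟨(CStarAlgebra.approximateUnit (compactsSubalgebra A Y)).map Subtype.val, inferInstance,
    ?_, fun T hT => ?_⟩
  · rw [eventually_map]
    filter_upwards [hl.eventually_norm] with S hS using ⟨S.2, hS⟩
  · exact tendsto_map'_iff.mpr ((continuous_subtype_val.tendsto _).comp
      (hl.tendsto_mul_right (⟨T, hT⟩ : compactsSubalgebra A Y)))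

/-- With `R = S - 1`, `‖R x‖ ^ 2 ≤ ‖θ_{Rx,Rx}‖ = ‖R θ_{x,x} R^*‖ ≤ 2 ‖S θ_{x,x} - θ_{x,x}‖`; the
factor 2 bounds `‖R^*‖`. -/
theorem tendsto_apply_of_tendsto_mul {l : Filter (Adjointable A Y)}
    (h1 : ∀ᶠ S in l, ‖S‖ ≤ 1) (h : ∀ T ∈ compacts A Y, Tendsto (fun S => S * T) l (𝓝 T)) (x : Y) :
    Tendsto (fun S : Adjointable A Y => S.1 x) l (𝓝 x) := by
  have h2 := h _ (theta_mem x x)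
  have h3 : Tendsto (fun S => √(2 * ‖S * theta A x x - theta A x x‖)) l (𝓝 0) := by
    have : Tendsto (fun S => √(2 * ‖S * theta A x x - theta A x x‖)) l
        (𝓝 √(2 * ‖theta A x x - theta A x x‖)) :=
      (Real.continuous_sqrt.tendsto _).comp ((h2.sub tendsto_const_nhds).norm.const_mul 2)
    simpa using this
  refine tendsto_iff_norm_sub_tendsto_zero.mpr
    (squeeze_zero' (Eventually.of_forall fun _ => norm_nonneg _) ?_ h3)
  filter_upwards [h1] with S hS
  refine Real.le_sqrt_of_sq_le ((norm_sq_le_norm_theta_self (A := A) _).trans ?_)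
  set R : Adjointable A Y := S - 1 with hR
  have e1 : S.1 x - x = R.1 x := rfl
  have e2 : theta A (R.1 x) (R.1 x) = (S * theta A x x - theta A x x) * star R := by
    rw [← one_mul (theta A x x), ← mul_assoc, mul_one, ← sub_mul, ← hR, mul_theta, theta_mul_eq,
      star_star]
  have h4 : ‖star R‖ ≤ 2 := by
    rw [norm_star, hR]
    calc ‖S - 1‖ ≤ ‖S‖ + ‖(1 : Adjointable A Y)‖ := norm_sub_le _ _
      _ ≤ 1 + 1 := add_le_add hS ContinuousLinearMap.norm_id_le
      _ = 2 := one_add_one_eq_two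
  rw [e1, e2, mul_comm (2 : ℝ)]
  exact (norm_mul_le _ _).trans (mul_le_mul_of_nonneg_left h4 (norm_nonneg _))

end Compacts

/-! ### Creation, annihilation and compression on `Y ⊗_φ X` -/

section Tensor

variable {A X : Type u} [NonUnitalCStarAlgebra A] [PartialOrder A] [StarOrderedRing A]
  [NormedAddCommGroup X] [NormedSpace ℂ X] [CompleteSpace X] [HilbertModule A X]
  {Y : Type*} [NormedAddCommGroup Y] [NormedSpace ℂ Y] [HilbertModule A Y]
  (φ : A →⋆ₙₐ[ℂ] Adjointable A X)

theorem mem_idealSub_one {x : Y} : x ∈ idealSub φ Y 1 ↔ φ (inner A x x) = 0 :=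
  ⟨fun h => h 1 one_pos le_rfl, fun h m h0 hm => by
    obtain rfl : m = 1 := le_antisymm hm h0
    exact h⟩

theorem restrict_eq_zero_iff {n : ℕ} {T : Adjointable A Y} :
    restrict φ n T = 0 ↔ ∀ x ∈ idealSub φ Y n, T.1 x = 0 :=
  ⟨fun h x hx => (restrict_apply φ T ⟨x, hx⟩).symm.trans (by rw [h]; rfl),
    fun h => Subtype.ext <| ContinuousLinearMap.ext fun x => Subtype.ext (h x.1 x.2)⟩

theorem theta_sub (x x' y : Y) : theta A (x - x') y = theta A x y - theta A x' y :=
  Adjointable.ext_inner fun v w => by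
    change inner A v (op (inner A y w) • (x - x')) =
      inner A v (op (inner A y w) • x - op (inner A y w) • x')
    rw [inner_sub, inner_op_smul, inner_op_smul, inner_op_smul, inner_sub, sub_mul]

theorem norm_theta_le (x y : Y) : ‖theta A x y‖ ≤ ‖x‖ * ‖y‖ :=
  ContinuousLinearMap.opNorm_le_bound _ (by positivity) fun z =>
    (norm_op_smul_le _ _).trans <| by rw [mul_assoc]; gcongr; exact norm_inner_le _ _

theorem tendsto_theta {ι : Type*} {l : Filter ι} {f : ι → Y} {x : Y} (h : Tendsto f l (𝓝 x))
    (y : Y) : Tendsto (fun i => theta A (f i) y) l (𝓝 (theta A x y)) := by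
  rw [tendsto_iff_norm_sub_tendsto_zero] at h ⊢
  refine squeeze_zero (fun _ => norm_nonneg _) (fun i => ?_) (by simpa using h.mul_const ‖y‖)
  rw [← theta_sub]
  exact norm_theta_le _ _

namespace BalancedTensor

variable {φ} in
-- No closure under scalars is required, since a scalar can be absorbed into an elementary tensor.
theorem induction_on {p : BalancedTensor Y φ → Prop} (z : BalancedTensor Y φ)
    (hc : IsClosed {z | p z}) (h0 : p 0) (htmul : ∀ ξ η, p (tmul φ ξ η))
    (hadd : ∀ x y, p x → p y → p (x + y)) : p z := by
  refine Completion.induction_on (α := PreTensor Y φ) z hc fun u => ?_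
  let c : PreTensor Y φ →L[ℂ] BalancedTensor Y φ := Completion.toComplL
  suffices h : ∀ u : Y ⊗[ℂ] X, p (c u) from h u
  intro u
  induction u with
  | zero => exact (map_zero c).symm ▸ h0
  | add x y hx hy => exact (map_add c x y).symm ▸ hadd _ _ hx hy
  | tmul ξ η => exact htmul ξ η

theorem norm_tmul_le (ξ : Y) (η : X) : ‖tmul φ ξ η‖ ≤ ‖ξ‖ * ‖η‖ := by
  refine le_of_sq_le_sq ?_ (by positivity)
  rw [norm_sq_eq (A := A), inner_tmul]
  have h1 : ‖φ (inner A ξ ξ)‖ ≤ ‖ξ‖ ^ 2 := by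
    rw [norm_sq_eq (A := A) ξ]
    exact NonUnitalStarAlgHom.norm_apply_le _ _
  calc _ ≤ ‖η‖ * (‖φ (inner A ξ ξ)‖ * ‖η‖) :=
        (norm_inner_le _ _).trans (by gcongr; exact (φ (inner A ξ ξ)).1.le_opNorm η)
    _ ≤ ‖η‖ * (‖ξ‖ ^ 2 * ‖η‖) := by gcongr
    _ = _ := by ring

theorem tmul_smul (c : ℂ) (ξ : Y) (η : X) : tmul φ ξ (c • η) = c • tmul φ ξ η :=
  inner_ext fun _ _ => by simp only [smul_inner, inner_tmul]

/-- The continuous linear map `ξ ↦ ξ ⊗ η`. -/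
def tmulRight (η : X) : Y →L[ℂ] BalancedTensor Y φ :=
  LinearMap.mkContinuous
    { toFun := fun ξ => tmul φ ξ η
      map_add' := fun ξ ξ' => add_tmul ξ ξ' η
      map_smul' := fun c ξ => smul_tmul c ξ η } ‖η‖
    (fun ξ => (norm_tmul_le φ ξ η).trans (mul_comm _ _).le)

/-- The creation operator `η ↦ ξ ⊗ η`. -/
def creation (ξ : Y) : X →L[ℂ] BalancedTensor Y φ :=
  LinearMap.mkContinuous
    { toFun := tmul φ ξ
      map_add' := tmul_add ξ
      map_smul' := fun c η => tmul_smul φ c ξ η } ‖ξ‖ (norm_tmul_le φ ξ)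

/-- On the algebraic tensor product the map `F` is adjoint to `ζ ↦ ξ ⊗ ζ`. Boundedness follows by
testing against `F u` itself: `‖F u‖ ^ 2 = ‖⟨ξ ⊗ F u, u⟩‖ ≤ ‖ξ‖ ‖F u‖ ‖u‖`, after which one factor
`‖F u‖` cancels. -/
theorem exists_annihilation (ξ : Y) : ∃ a : BalancedTensor Y φ →L[ℂ] X,
    ∀ ξ' η, a (tmul φ ξ' η) = (φ (inner A ξ ξ')).1 η := by
  let F : Y ⊗[ℂ] X →ₗ[ℂ] X := TensorProduct.lift <| LinearMap.mk₂ ℂ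
    (fun ξ' η => (φ (inner A ξ ξ')).1 η)
    (fun _ _ _ => by simp [inner_add]) (fun _ _ _ => by simp [inner_smul])
    (fun _ _ _ => by simp) (fun _ _ _ => by simp)
  have hF : ∀ (ζ : X) (u : Y ⊗[ℂ] X),
      inner A ζ (F u) = PreTensor.semiInner φ (ξ ⊗ₜ ζ) u := fun ζ u => by
    induction u with
    | zero => rw [map_zero, map_zero, inner_zero]
    | add x y hx hy => rw [map_add, map_add, inner_add, hx, hy]
    | tmul ξ' η => rfl
  have hb : ∀ u : Y ⊗[ℂ] X, ‖F u‖ ≤ ‖ξ‖ * ‖(show PreTensor Y φ from u)‖ := fun u => by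
    have h1 : ‖F u‖ * ‖F u‖ ≤ ‖ξ‖ * ‖(show PreTensor Y φ from u)‖ * ‖F u‖ := by
      calc _ = ‖PreTensor.semiInner φ (ξ ⊗ₜ F u) u‖ := by rw [← hF, ← norm_sq_eq, sq]
        _ ≤ ‖(show PreTensor Y φ from ξ ⊗ₜ[ℂ] F u)‖ * ‖(show PreTensor Y φ from u)‖ := PreTensor.norm_semiInner_le' φ _ u
        _ ≤ ‖ξ‖ * ‖F u‖ * ‖(show PreTensor Y φ from u)‖ := by
          refine mul_le_mul_of_nonneg_right ?_ (norm_nonneg _)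
          exact (Completion.norm_coe _).symm.le.trans (norm_tmul_le φ ξ (F u))
        _ = _ := by ring
    rcases (norm_nonneg (F u)).eq_or_lt with h | h
    · rw [← h]; positivity
    · exact le_of_mul_le_mul_right h1 h
  let G : PreTensor Y φ →L[ℂ] X :=
    LinearMap.mkContinuous (F : PreTensor Y φ →ₗ[ℂ] X) ‖ξ‖ hb
  let H : TensorCompletion Y φ →L[ℂ] X := G.fromCompletion
  exact ⟨H, fun ξ' η => G.fromCompletion_apply_coe _⟩

/-- The annihilation operator `ξ' ⊗ η ↦ φ(⟨ξ, ξ'⟩) η`, adjoint to `creation`. -/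
def annihilation (ξ : Y) : BalancedTensor Y φ →L[ℂ] X := (exists_annihilation φ ξ).choose

theorem annihilation_tmul (ξ ξ' : Y) (η : X) :
    annihilation φ ξ (tmul φ ξ' η) = (φ (inner A ξ ξ')).1 η :=
  (exists_annihilation φ ξ).choose_spec ξ' η

theorem inner_annihilation (ξ : Y) (η : X) (z : BalancedTensor Y φ) :
    inner A η (annihilation φ ξ z) = inner A (tmul φ ξ η) z := by
  have : (innerCLM A η).comp (annihilation φ ξ) = innerCLM A (tmul φ ξ η) :=
    clm_ext fun ξ' η' => by
      rw [innerCLM_apply, inner_tmul, ContinuousLinearMap.comp_apply, annihilation_tmul,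
        innerCLM_apply]
  exact DFunLike.congr_fun this z

theorem annihilation_inner (ξ : Y) (η : X) (z : BalancedTensor Y φ) :
    inner A (annihilation φ ξ z) η = inner A z (tmul φ ξ η) := by
  rw [← star_inner, inner_annihilation, star_inner]

theorem annihilation_op_smul (ξ : Y) (z : BalancedTensor Y φ) (a : A) :
    annihilation φ ξ (op a • z) = op a • annihilation φ ξ z :=
  eq_of_inner (A := A) fun η => by
    rw [inner_annihilation, inner_op_smul, inner_op_smul, inner_annihilation]

/-- The compression `η ↦ θ_ξ^* S θ_{ξ'} η` of an operator on `Y ⊗_φ X` to `X`. -/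
def compress (ξ ξ' : Y) (S : Adjointable A (BalancedTensor Y φ)) : Adjointable A X :=
  Adjointable.mk ((annihilation φ ξ).comp (S.1.comp (creation φ ξ')))
    ((annihilation φ ξ').comp ((star S).1.comp (creation φ ξ))) fun x y => by
      change inner A (annihilation φ ξ (S.1 (tmul φ ξ' x))) y =
        inner A x (annihilation φ ξ' ((star S).1 (tmul φ ξ y)))
      rw [annihilation_inner, inner_annihilation, Adjointable.inner_left]

theorem compress_apply (ξ ξ' : Y) (S : Adjointable A (BalancedTensor Y φ)) (η : X) :
    (compress φ ξ ξ' S).1 η = annihilation φ ξ (S.1 (tmul φ ξ' η)) := rfl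

theorem continuous_compress (ξ ξ' : Y) : Continuous (compress φ ξ ξ') := by
  refine Continuous.subtype_mk ?_ _
  exact continuous_const.clm_comp (continuous_subtype_val.clm_comp continuous_const)

theorem compress_theta (ξ ξ' : Y) (x y : BalancedTensor Y φ) :
    compress φ ξ ξ' (theta A x y) =
      theta A (annihilation φ ξ x) (annihilation φ ξ' y) :=
  Subtype.ext <| ContinuousLinearMap.ext fun η => by
    rw [compress_apply, theta_apply, theta_apply, annihilation_op_smul, annihilation_inner]

/-- `compress` as a continuous linear map. -/
def compressCLM (ξ ξ' : Y) :
    Adjointable A (BalancedTensor Y φ) →L[ℂ] Adjointable A X where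
  toFun := compress φ ξ ξ'
  map_add' S T := Subtype.ext <| ContinuousLinearMap.ext fun η =>
    map_add (annihilation φ ξ) (S.1 (tmul φ ξ' η)) (T.1 (tmul φ ξ' η))
  map_smul' c S := Subtype.ext <| ContinuousLinearMap.ext fun η =>
    map_smul (annihilation φ ξ) c (S.1 (tmul φ ξ' η))
  cont := continuous_compress φ ξ ξ'

/-- Compression is linear and continuous and takes rank-one operators to rank-one operators. -/
theorem compress_mem_compacts (ξ ξ' : Y) {S : Adjointable A (BalancedTensor Y φ)}
    (hS : S ∈ compacts A (BalancedTensor Y φ)) : compress φ ξ ξ' S ∈ compacts A X := by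
  refine compacts_induction (p := fun S => compressCLM φ ξ ξ' S ∈ compacts A X)
    ((Submodule.isClosed_topologicalClosure _).preimage (compressCLM φ ξ ξ').continuous)
    ?_ (fun x y => ?_) (fun S T hS hT => ?_) (fun c T hT => ?_) hS
  · rw [map_zero]; exact zero_mem _
  · change compress φ ξ ξ' (theta A x y) ∈ compacts A X
    rw [compress_theta]
    exact theta_mem _ _
  · rw [map_add]; exact add_mem hS hT
  · rw [map_smul]; exact Submodule.smul_mem _ c hT

end BalancedTensor

/-! ### Controlling an operator by `T|_{Y ker φ}` and `T ⊗ 1` -/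

variable [CompleteSpace Y]

/-- Together with `compress_mem_compacts` this shows that `φ(⟨ξ, T ξ'⟩)` is compact whenever `T ⊗ 1`
is, which is one half of membership in Katsura's ideal. -/
theorem BalancedTensor.compress_tensorOne (ξ ξ' : Y) (T : Adjointable A Y) :
    compress φ ξ ξ' (tensorOne φ T) = φ (inner A ξ (T.1 ξ')) :=
  Subtype.ext <| ContinuousLinearMap.ext fun η => by
    rw [compress_apply, tensorOne_tmul, annihilation_tmul]

/-- The pair of `*`-homomorphisms `S ↦ S|_{Y ker φ}` and `S ↦ S ⊗ 1`. -/
def restrictProdTensorOne : Adjointable A Y →⋆ₙₐ[ℂ]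
    Adjointable A (idealSub φ Y 1) × Adjointable A (BalancedTensor Y φ) :=
  (restrict φ 1).prod (BalancedTensor.tensorOne φ)

/-- If `S ⊗ 1 = 0`, then `⟨ζ, φ(⟨Sx, Sx⟩) η⟩ = ⟨Sx ⊗ ζ, (S ⊗ 1)(x ⊗ η)⟩ = 0`, so the range of `S`
lies in `Y ker φ`. If also `S|_{Y ker φ} = 0`, its adjoint `S^*|_{Y ker φ}` is zero too, whence `S^*
S = 0`. -/
theorem restrictProdTensorOne_injective :
    Function.Injective (restrictProdTensorOne (Y := Y) φ) := by
  rw [injective_iff_map_eq_zero]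
  intro S hS
  have h1 : restrict φ 1 S = 0 := congrArg Prod.fst hS
  have h2 : BalancedTensor.tensorOne φ S = 0 := congrArg Prod.snd hS
  have h3 : ∀ x, S.1 x ∈ idealSub φ Y 1 := fun x => (mem_idealSub_one φ).mpr <|
    Subtype.ext <| ContinuousLinearMap.ext fun η => eq_of_inner (A := A) fun ζ => by
      rw [← BalancedTensor.inner_tmul, ← BalancedTensor.tensorOne_tmul φ S x η, h2]
      exact (inner_zero _).trans (inner_zero _).symm
  have h4 := (restrict_eq_zero_iff φ).mp ((restrict_star φ 1 S).trans
    ((congrArg star h1).trans (star_zero _)))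
  refine (CStarRing.star_mul_self_eq_zero_iff S).mp (Subtype.ext <| ContinuousLinearMap.ext
    fun x => h4 _ (h3 x))

variable {φ}

/-- An injective `*`-homomorphism is isometric, and the norm on the product is the maximum. -/
theorem norm_tensorOne_eq {S : Adjointable A Y} (h : restrict φ 1 S = 0) :
    ‖BalancedTensor.tensorOne φ S‖ = ‖S‖ := by
  have h1 := NonUnitalStarAlgHom.norm_map (restrictProdTensorOne (Y := Y) φ)
    (restrictProdTensorOne_injective φ) S
  rw [← h1]
  change _ = max ‖restrict φ 1 S‖ ‖BalancedTensor.tensorOne φ S‖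
  rw [h, norm_zero, max_eq_right (norm_nonneg _)]

/-- Clear on elementary tensors; the uniform bound `‖S ⊗ 1‖ ≤ ‖S‖ ≤ 1` extends it to the completion.
-/
theorem tendsto_tensorOne_apply {l : Filter (Adjointable A Y)} (h1 : ∀ᶠ S in l, ‖S‖ ≤ 1)
    (h : ∀ x, Tendsto (fun S : Adjointable A Y => S.1 x) l (𝓝 x)) (z : BalancedTensor Y φ) :
    Tendsto (fun S => (BalancedTensor.tensorOne φ S).1 z) l (𝓝 z) := by
  have hc := isClosed_setOf_tendsto_self l (fun S => ⇑(BalancedTensor.tensorOne φ S).1) (by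
    filter_upwards [h1] with S hS
    refine AddMonoidHomClass.lipschitz_of_bound_nnnorm (BalancedTensor.tensorOne φ S).1 1 fun x => ?_
    refine (ContinuousLinearMap.le_opNorm _ x).trans ?_
    refine mul_le_mul_of_nonneg_right ?_ (norm_nonneg _)
    exact (NonUnitalStarAlgHom.norm_apply_le (BalancedTensor.tensorOne φ) S).trans hS)
  refine BalancedTensor.induction_on z hc ?_ (fun ξ η => ?_) fun x y hx hy => ?_
  · simp only [map_zero]
    exact tendsto_const_nhds
  · simp_rw [BalancedTensor.tensorOne_tmul]
    have e : ∀ ξ : Y, BalancedTensor.tmul φ ξ η = (BalancedTensor.tmulRight φ η) ξ := fun _ => rfl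
    simp_rw [e]
    exact ((BalancedTensor.tmulRight φ η).continuous.tendsto ξ).comp (h ξ)
  · simp only [map_add]
    exact hx.add hy

/-- Along an approximate unit of `𝓚(Y)`, `S ⊗ 1` tends strongly to the identity, so `(S ⊗ 1) K → K`
in norm for every compact `K`, in particular for `K = T ⊗ 1`. As `S T - T` vanishes on `Y ker φ`,
amplification preserves its norm. Hence `T` is a norm limit of the compact operators `S T`. -/
theorem mem_compacts_of_tensorOne {T : Adjointable A Y}
    (hT : BalancedTensor.tensorOne φ T ∈ compacts A (BalancedTensor Y φ))
    (h : restrict φ 1 T = 0) : T ∈ compacts A Y := by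
  obtain ⟨l, hl, hl1, hlc⟩ := exists_compacts_approximateUnit A Y
  have hn : ∀ᶠ S in l, ‖S‖ ≤ 1 := hl1.mono fun _ h => h.2
  have hz := tendsto_tensorOne_apply (φ := φ) hn (tendsto_apply_of_tendsto_mul hn hlc)
  have hK : ∀ K ∈ compacts A (BalancedTensor Y φ),
      Tendsto (fun S => BalancedTensor.tensorOne φ S * K) l (𝓝 K) := by
    intro K hK
    refine compacts_induction
      (p := fun K => Tendsto (fun S => BalancedTensor.tensorOne φ S * K) l (𝓝 K))
      ?_ ?_ ?_ ?_ ?_ hK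
    · refine isClosed_setOf_tendsto_self l (fun S K => BalancedTensor.tensorOne φ S * K) ?_
      filter_upwards [hn] with S hS
      refine LipschitzWith.of_dist_le_mul fun K K' => ?_
      rw [dist_eq_norm, dist_eq_norm, ← mul_sub, NNReal.coe_one]
      refine (norm_mul_le _ _).trans (mul_le_mul_of_nonneg_right ?_ (norm_nonneg _))
      exact (NonUnitalStarAlgHom.norm_apply_le (BalancedTensor.tensorOne φ) S).trans hS
    · simp only [mul_zero]
      exact tendsto_const_nhds
    · intro x y
      simp_rw [mul_theta]
      -- On a rank-one operator, strong convergence at `x` is already norm convergence: `(S ⊗ 1)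
      -- θ_{x,y} = θ_{(S ⊗ 1)x, y}`.
      exact tendsto_theta (hz x) y
    · intro S T hS hT
      simp_rw [mul_add]
      exact hS.add hT
    · intro c T hT
      simp_rw [mul_smul_comm]
      exact hT.const_smul c
  have h2 : Tendsto (fun S => S * T) l (𝓝 T) := by
    rw [tendsto_iff_norm_sub_tendsto_zero]
    refine (tendsto_iff_norm_sub_tendsto_zero.mp (hK _ hT)).congr fun S => ?_
    rw [← map_mul, ← map_sub]
    refine norm_tensorOne_eq ?_
    rw [map_sub, map_mul, h, mul_zero, sub_zero]
  have : T ∈ closure (compacts A Y : Set (Adjointable A Y)) :=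
    mem_closure_of_tendsto h2 (hl1.mono fun S hS => mul_mem_compacts' hS.1 T)
  exact closure_minimal subset_rfl (Submodule.isClosed_topologicalClosure _) this

end Tensor

/-! ### Algebraic identities for the map `𝓚(Y) → B` -/

section ModuleRep

variable {A : Type*} [NonUnitalCStarAlgebra A] [PartialOrder A] [StarOrderedRing A]
variable {Y : Type*} [NormedAddCommGroup Y] [NormedSpace ℂ Y] [HilbertModule A Y] [CompleteSpace Y]
variable {B : Type*} [NonUnitalCStarAlgebra B]

namespace ModuleRep

variable {π : A →⋆ₙₐ[ℂ] B} (f : ModuleRep π Y)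

theorem compactMap_mul_toLM (S : compacts A Y) (z : Y) :
    f.compactMap S * f.toLM z = f.toLM (S.1.1 z) := by
  refine compacts_subtype_induction (p := fun S => f.compactMap S * f.toLM z = f.toLM (S.1.1 z))
    ?_ ?_ (fun x y => ?_) (fun S T hS hT => ?_) (fun c T hT => ?_) S
  · refine isClosed_eq (f.compactMap.continuous.mul continuous_const)
      (f.continuous_toLM.comp ?_)
    exact (ContinuousLinearMap.apply ℂ Y z).continuous.comp
      (continuous_subtype_val.comp continuous_subtype_val)
  · rw [f.compactMap.map_zero, zero_mul]
    exact (map_zero f.toLM).symm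
  · rw [compactMap_theta, mul_assoc, f.star_mul_map, theta_apply, f.map_op_smul]
  · rw [f.compactMap.map_add, add_mul, hS, hT]
    exact (map_add f.toLM _ _).symm
  · rw [f.compactMap.map_smul, smul_mul_assoc, hT]
    exact (map_smul f.toLM _ _).symm

theorem compactMap_star (S T : compacts A Y) (h : T.1 = star S.1) :
    f.compactMap T = star (f.compactMap S) := by
  obtain rfl : T = ⟨star S.1, star_mem_compacts S.2⟩ := Subtype.ext h
  refine compacts_subtype_induction
    (p := fun S => f.compactMap ⟨star S.1, star_mem_compacts S.2⟩ = star (f.compactMap S))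
    ?_ ?_ (fun x y => ?_) (fun S T hS hT => ?_) (fun c T hT => ?_) S
  · exact isClosed_eq (f.compactMap.continuous.comp
      ((continuous_star.comp continuous_subtype_val).subtype_mk _))
      (continuous_star.comp f.compactMap.continuous)
  · rw [f.compactMap.map_zero, star_zero, ← f.compactMap.map_zero]
    exact congrArg _ (Subtype.ext (star_zero _))
  · rw [compactMap_theta, star_mul, star_star, ← compactMap_theta]
    exact congrArg _ (Subtype.ext (star_theta x y))
  · rw [f.compactMap.map_add, star_add, ← hS, ← hT, ← f.compactMap.map_add]
    exact congrArg _ (Subtype.ext (star_add _ _))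
  · rw [f.compactMap.map_smul, star_smul, ← hT, ← f.compactMap.map_smul]
    exact congrArg _ (Subtype.ext (star_smul _ _))

/-- The image of `𝓚(Y)` lies in the closed span of the products `f(x) f(y)^*`, so killing every
`f(x)` from the left suffices. -/
theorem mul_compactMap_eq_zero {c : B} (h : ∀ z, c * f.toLM z = 0) (S : compacts A Y) :
    c * f.compactMap S = 0 := by
  refine compacts_subtype_induction (p := fun S => c * f.compactMap S = 0)
    (isClosed_eq (continuous_const.mul f.compactMap.continuous) continuous_const)
    ?_ (fun x y => ?_) (fun S T hS hT => ?_) (fun r T hT => ?_) S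
  · rw [f.compactMap.map_zero, mul_zero]
  · rw [compactMap_theta, ← mul_assoc, h, zero_mul]
  · rw [f.compactMap.map_add, mul_add, hS, hT, add_zero]
  · rw [f.compactMap.map_smul, mul_smul_comm, hT, smul_zero]

/-- An element of `B` that acts on the range of `f` as `R` acts on the image of `𝓚(Y)` as left
multiplication by `R`. The product is passed as a separate `U` so that callers may supply it in
whatever form they have. -/
theorem mul_compactMap_eq (b : B) (R : Adjointable A Y)
    (h : ∀ z, b * f.toLM z = f.toLM (R.1 z)) (S U : compacts A Y) (hU : U.1 = R * S.1) :
    b * f.compactMap S = f.compactMap U := by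
  obtain rfl : U = ⟨R * S.1, mul_mem_compacts R S.2⟩ := Subtype.ext hU
  refine compacts_subtype_induction
    (p := fun S => b * f.compactMap S = f.compactMap ⟨R * S.1, mul_mem_compacts R S.2⟩)
    ?_ ?_ (fun x y => ?_) (fun S T hS hT => ?_) (fun c T hT => ?_) S
  · exact isClosed_eq (continuous_const.mul f.compactMap.continuous)
      (f.compactMap.continuous.comp
        (((continuous_const_mul R).comp continuous_subtype_val).subtype_mk _))
  · rw [f.compactMap.map_zero, mul_zero, ← f.compactMap.map_zero]
    exact congrArg _ (Subtype.ext (mul_zero _).symm)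
  · rw [compactMap_theta, ← mul_assoc, h, ← compactMap_theta]
    exact congrArg _ (Subtype.ext (mul_theta R x y).symm)
  · rw [f.compactMap.map_add, mul_add, hS, hT, ← f.compactMap.map_add]
    exact congrArg _ (Subtype.ext (mul_add _ _ _).symm)
  · rw [f.compactMap.map_smul, mul_smul_comm, hT, ← f.compactMap.map_smul]
    exact congrArg _ (Subtype.ext (mul_smul_comm _ _ _).symm)

end ModuleRep
end ModuleRep

/-! ### Katsura covariance identifies `T` with `T ⊗ 1` in `B` -/

section Tensor

variable {A X : Type u} [NonUnitalCStarAlgebra A] [PartialOrder A] [StarOrderedRing A]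
  [NormedAddCommGroup X] [NormedSpace ℂ X] [CompleteSpace X] [HilbertModule A X]
  {φ : A →⋆ₙₐ[ℂ] Adjointable A X} {B : Type v} [NonUnitalCStarAlgebra B]
  {Y : Type*} [NormedAddCommGroup Y] [NormedSpace ℂ Y] [HilbertModule A Y]
  {ψ : BimoduleRep φ B} {f : ModuleRep ψ.π Y} {g : ModuleRep ψ.π (BalancedTensor Y φ)}

namespace ModuleRep

/-- On elementary tensors, `f(ξ)^* f(ξ') t(η) = π(⟨ξ, ξ'⟩) t(η) = t(φ(⟨ξ, ξ'⟩) η)`. -/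
theorem star_mul_toLM_tensor (hg : ∀ ξ η, g.toLM (BalancedTensor.tmul φ ξ η) = f.toLM ξ * ψ.t η)
    (ξ : Y) (z : BalancedTensor Y φ) :
    star (f.toLM ξ) * g.toLM z = ψ.t (BalancedTensor.annihilation φ ξ z) := by
  refine BalancedTensor.induction_on
    (p := fun z => star (f.toLM ξ) * g.toLM z = ψ.t (BalancedTensor.annihilation φ ξ z))
    z ?_ ?_ (fun ξ' η => ?_) fun x y hx hy => ?_
  · exact isClosed_eq (continuous_const.mul g.continuous_toLM)
      (ψ.toModuleRep.continuous_toLM.comp (BalancedTensor.annihilation φ ξ).continuous)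
  · rw [map_zero, map_zero, mul_zero, map_zero]
  · rw [hg, ← mul_assoc, f.star_mul_map, ψ.map_left, BalancedTensor.annihilation_tmul]
  · rw [map_add, map_add, mul_add, map_add, hx, hy]

/-- Cutting down by `f(ξ)^*` and `f(ξ')` brings the compacts of `Y ⊗_φ X` back to `𝓚(X)`, the only
level at which covariance says anything. -/
theorem star_mul_compactMap_mul
    (hg : ∀ ξ η, g.toLM (BalancedTensor.tmul φ ξ η) = f.toLM ξ * ψ.t η) (ξ ξ' : Y)
    (S : compacts A (BalancedTensor Y φ)) :
    star (f.toLM ξ) * g.compactMap S * f.toLM ξ' = ψ.toModuleRep.compactMap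
      ⟨_, BalancedTensor.compress_mem_compacts φ ξ ξ' S.2⟩ := by
  refine compacts_subtype_induction (p := fun S => star (f.toLM ξ) * g.compactMap S * f.toLM ξ' =
    ψ.toModuleRep.compactMap ⟨_, BalancedTensor.compress_mem_compacts φ ξ ξ' S.2⟩)
    ?_ ?_ (fun x y => ?_) (fun S T hS hT => ?_) (fun c T hT => ?_) S
  · exact isClosed_eq ((continuous_const.mul g.compactMap.continuous).mul continuous_const)
      (ψ.toModuleRep.compactMap.continuous.comp
        (((BalancedTensor.continuous_compress φ ξ ξ').comp continuous_subtype_val).subtype_mk _))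
  · rw [g.compactMap.map_zero, mul_zero, zero_mul, ← ψ.toModuleRep.compactMap.map_zero]
    exact congrArg _ (Subtype.ext (map_zero (BalancedTensor.compressCLM φ ξ ξ')).symm)
  · rw [compactMap_theta, ← mul_assoc, star_mul_toLM_tensor hg, mul_assoc,
      ← star_star (f.toLM ξ'), ← star_mul, star_mul_toLM_tensor hg]
    refine (ψ.toModuleRep.compactMap_theta _ _).symm.trans ?_
    exact congrArg _ (Subtype.ext (BalancedTensor.compress_theta φ ξ ξ' x y).symm)
  · rw [g.compactMap.map_add, mul_add, add_mul, hS, hT, ← ψ.toModuleRep.compactMap.map_add]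
    exact congrArg _ (Subtype.ext (map_add (BalancedTensor.compressCLM φ ξ ξ') _ _).symm)
  · rw [g.compactMap.map_smul, mul_smul_comm, smul_mul_assoc, hT,
      ← ψ.toModuleRep.compactMap.map_smul]
    exact congrArg _ (Subtype.ext (map_smul (BalancedTensor.compressCLM φ ξ ξ') _ _).symm)

variable [CompleteSpace Y]

theorem mul_toLM_tensor (hg : ∀ ξ η, g.toLM (BalancedTensor.tmul φ ξ η) = f.toLM ξ * ψ.t η)
    {b : B} {R : Adjointable A Y} (h : ∀ ξ, b * f.toLM ξ = f.toLM (R.1 ξ))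
    (z : BalancedTensor Y φ) :
    b * g.toLM z = g.toLM ((BalancedTensor.tensorOne φ R).1 z) := by
  refine BalancedTensor.induction_on
    (p := fun z => b * g.toLM z = g.toLM ((BalancedTensor.tensorOne φ R).1 z))
    z ?_ ?_ (fun ξ η => ?_) fun x y hx hy => ?_
  · exact isClosed_eq (continuous_const.mul g.continuous_toLM)
      (g.continuous_toLM.comp (BalancedTensor.tensorOne φ R).1.continuous)
  · rw [map_zero, map_zero, mul_zero, map_zero]
  · rw [hg, BalancedTensor.tensorOne_tmul, hg, ← mul_assoc, h]
  · rw [map_add, map_add, mul_add, map_add, hx, hy]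

/-- Let `c` be the difference of the two sides. Both `c` and `c^*` kill the range of `g`, because
`T` acts there as `T ⊗ 1`. Covariance shows that `c` also kills the range of `f`. Hence `c`
annihilates both terms of `c^*`, so `c c^* = 0`. -/
theorem compactMap_eq_compactMap_tensorOne (hψ : ψ.IsCuntzPimsnerCovariant)
    (hg : ∀ ξ η, g.toLM (BalancedTensor.tmul φ ξ η) = f.toLM ξ * ψ.t η)
    (T : compacts A Y) (hT : BalancedTensor.tensorOne φ T.1 ∈ compacts A (BalancedTensor Y φ))
    (h0 : restrict φ 1 T.1 = 0) :
    f.compactMap T = g.compactMap ⟨_, hT⟩ := by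
  have hg0 : ∀ z, (f.compactMap T - g.compactMap ⟨_, hT⟩) * g.toLM z = 0 := fun z => by
    rw [sub_mul, mul_toLM_tensor hg (f.compactMap_mul_toLM T), compactMap_mul_toLM, sub_self]
  have hTs : BalancedTensor.tensorOne φ (star T.1) ∈ compacts A (BalancedTensor Y φ) := by
    rw [map_star]; exact star_mem_compacts hT
  have hs : f.compactMap ⟨_, star_mem_compacts T.2⟩ - g.compactMap ⟨_, hTs⟩ =
      star (f.compactMap T - g.compactMap ⟨_, hT⟩) := by
    rw [star_sub, f.compactMap_star T _ rfl, g.compactMap_star ⟨_, hT⟩ ⟨_, hTs⟩ (map_star _ _)]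
  have hgs : ∀ z, star (f.compactMap T - g.compactMap ⟨_, hT⟩) * g.toLM z = 0 := fun z => by
    rw [← hs, sub_mul, mul_toLM_tensor hg (f.compactMap_mul_toLM _), compactMap_mul_toLM, sub_self]
  set c := f.compactMap T - g.compactMap ⟨_, hT⟩ with hc
  have hf0 : ∀ ξ, c * f.toLM ξ = 0 := fun ξ => by
    -- This element is chosen because `f(ξ)^* c^* f(T ξ) = π(a) - t^{(1)}(φ(a))`, and because it
    -- lies in Katsura's ideal.
    set a := inner A ξ ((star T.1).1 (T.1.1 ξ)) with ha
    have hφa : BalancedTensor.compress φ ξ (T.1.1 ξ) (BalancedTensor.tensorOne φ (star T.1)) =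
        φ a := BalancedTensor.compress_tensorOne φ ξ (T.1.1 ξ) (star T.1)
    have hmem : φ a ∈ compacts A X :=
      hφa ▸ BalancedTensor.compress_mem_compacts φ ξ (T.1.1 ξ) hTs
    -- Here `a b = ⟨ξ, T^* T (ξ b)⟩`, and `ξ b` lies in `Y ker φ`, on which `T` vanishes.
    have hJ : ∀ b, φ b = 0 → a * b = 0 := fun b hb => by
      have h1 : op b • ξ ∈ idealSub φ Y 1 := (mem_idealSub_one φ).mpr <| by
        rw [inner_op_smul, map_mul, hb, mul_zero]
      rw [ha, ← Adjointable.inner_left, Adjointable.inner_right, ← inner_op_smul,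
        ← Adjointable.inner_right, (restrict_eq_zero_iff φ).mp h0 _ h1, inner_zero]
    have h2 : star (f.toLM ξ) * star c * f.toLM (T.1.1 ξ) = 0 := by
      rw [← hs, mul_sub, sub_mul, mul_assoc, compactMap_mul_toLM, f.star_mul_map,
        star_mul_compactMap_mul hg, sub_eq_zero]
      exact (hψ a hmem hJ).trans (congrArg _ (Subtype.ext hφa.symm))
    rw [← CStarRing.star_mul_self_eq_zero_iff, star_mul]
    -- Only the second `c` in `f(ξ)^* c^* c f(ξ)` is expanded: its first term gives `f(ξ)^* c^* f(T
    -- ξ) = 0`, and its second dies because `c^*` kills the image of `𝓚(Y ⊗_φ X)`.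
    nth_rewrite 2 [hc]
    rw [sub_mul, mul_sub, compactMap_mul_toLM, h2, mul_assoc, ← mul_assoc (star c),
      g.mul_compactMap_eq_zero hgs, zero_mul, mul_zero, sub_zero]
  have h1 : c * star c = 0 := by
    rw [← hs, mul_sub, f.mul_compactMap_eq_zero hf0, g.mul_compactMap_eq_zero hg0, sub_self]
  exact sub_eq_zero.mp ((CStarRing.mul_star_self_eq_zero_iff c).mp h1)

end ModuleRep

end Tensor

/-! ### Tensor powers, the partial sums `R_k`, and linearity of `ι̃` -/

section Powers

variable {A X : Type u} [NonUnitalCStarAlgebra A] [PartialOrder A] [StarOrderedRing A]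
  [NormedAddCommGroup X] [NormedSpace ℂ X] [CompleteSpace X] [HilbertModule A X]
  (φ : A →⋆ₙₐ[ℂ] Adjointable A X) {B : Type v} [NonUnitalCStarAlgebra B]

variable {φ} in
theorem leftAction_eq_zero {a : A} (ha : φ a = 0) : ∀ {m : ℕ}, 0 < m → leftAction φ m a = 0
  | 1, _ => ha
  | m + 2, _ => (congrArg (tensorOnePow φ m) (leftAction_eq_zero ha m.succ_pos)).trans
      (map_zero (tensorOnePow φ m))

/-- Each `φ_m` with `m ≥ 1` is an amplification of `φ`, so the intersection is already attained at
`m = 1`. -/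
theorem kerIdeal_eq {n : ℕ} (hn : 0 < n) : kerIdeal φ n = {a | φ a = 0} :=
  Set.ext fun _ => ⟨fun h => h 1 one_pos hn, fun h _ h0 _ => leftAction_eq_zero h h0⟩

theorem mem_idealSub_iff {Y : Type*} [NormedAddCommGroup Y] [NormedSpace ℂ Y] [HilbertModule A Y]
    {n : ℕ} (hn : 0 < n) {x : Y} : x ∈ idealSub φ Y n ↔ φ (inner A x x) = 0 := by
  change inner A x x ∈ kerIdeal φ n ↔ _
  rw [kerIdeal_eq φ hn]
  rfl

theorem restrict_one_eq_zero {Y : Type*} [NormedAddCommGroup Y] [NormedSpace ℂ Y]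
    [HilbertModule A Y] {n : ℕ} (hn : 0 < n) {T : Adjointable A Y} (h : restrict φ n T = 0) :
    restrict φ 1 T = 0 :=
  (restrict_eq_zero_iff φ).mpr fun x hx => (restrict_eq_zero_iff φ).mp h x <|
    (mem_idealSub_iff φ hn).mpr ((mem_idealSub_one φ).mp hx)

theorem eq_zero_of_restrict_zero {Y : Type*} [NormedAddCommGroup Y] [NormedSpace ℂ Y]
    [HilbertModule A Y] {T : Adjointable A Y} (h : restrict φ 0 T = 0) : T = 0 :=
  Subtype.ext <| ContinuousLinearMap.ext fun x => (restrict_eq_zero_iff φ).mp h x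
    fun _ h0 hm => absurd hm h0.not_ge

theorem ofCompact_leftMul (a : A) (h : leftMul A a ∈ compacts A (HilbertMod.unit A)) :
    ofCompact ⟨leftMul A a, h⟩ = a := leftMul_injective (leftMul_ofCompact _)

theorem ofCompact_add (S T : compacts A (HilbertMod.unit A)) :
    ofCompact (S + T) = ofCompact S + ofCompact T :=
  leftMul_injective <| by
    rw [leftMul_ofCompact, map_add, leftMul_ofCompact, leftMul_ofCompact]; rfl

theorem ofCompact_smul (c : ℂ) (S : compacts A (HilbertMod.unit A)) :
    ofCompact (c • S) = c • ofCompact S :=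
  leftMul_injective <| by
    rw [leftMul_ofCompact, map_smul, leftMul_ofCompact]; rfl

/-- `L_a` is the limit of `L_{ae} = θ_{a, e^*}` along an approximate unit of `A`. -/
theorem leftMul_mem_compacts (a : A) : leftMul A a ∈ compacts A (HilbertMod.unit A) := by
  have hl := CStarAlgebra.increasingApproximateUnit A
  have := hl.neBot
  have h1 : Tendsto (fun e => leftMul A (a * e)) (CStarAlgebra.approximateUnit A)
      (𝓝 (leftMul A a)) :=
    ((NonUnitalStarAlgHom.isometry (leftMul A) leftMul_injective).continuous.tendsto _).comp
      (hl.tendsto_mul_left a)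
  refine (Submodule.isClosed_topologicalClosure _).mem_of_tendsto h1
    (Eventually.of_forall fun e => ?_)
  have h2 : ∀ b : A, leftMul A (a * star b) ∈ compacts A (HilbertMod.unit A) := fun b =>
    theta_unit (A := A) a b ▸ theta_mem (A := A) (Y := HilbertMod.unit A) a b
  have h3 := h2 (star e)
  rwa [star_star] at h3

theorem iota_add (p q : ℕ) (S T : compacts A (tensorPow φ p)) :
    iota φ p q (S + T) = iota φ p q S + iota φ p q T := by
  match p, q with
  | 0, q =>
    rw [iota_zero_left, iota_zero_left, iota_zero_left]
    exact (congrArg (leftAction φ q) (ofCompact_add S T)).trans (map_add (leftAction φ q) _ _)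
  | p + 1, 0 => exact (add_zero (0 : Adjointable A (tensorPow φ 0))).symm
  | p + 1, q + 1 =>
    rw [iota_succ_succ, iota_succ_succ, iota_succ_succ]
    exact map_add (amplify φ p q) S.1 T.1

theorem iota_smul (p q : ℕ) (c : ℂ) (S : compacts A (tensorPow φ p)) :
    iota φ p q (c • S) = c • iota φ p q S := by
  match p, q with
  | 0, q =>
    rw [iota_zero_left, iota_zero_left]
    exact (congrArg (leftAction φ q) (ofCompact_smul c S)).trans (map_smul (leftAction φ q) c _)
  | p + 1, 0 => exact (smul_zero (A := Adjointable A (tensorPow φ 0)) c).symm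
  | p + 1, q + 1 =>
    rw [iota_succ_succ, iota_succ_succ]
    exact map_smul (amplify φ p q) c S.1

theorem block_add (k q p : ℕ) (S T : compacts A (tensorPow φ p)) :
    block φ k q p (S + T) = block φ k q p S + block φ k q p T := by
  by_cases h : p ≤ q
  · rw [block_of_le φ h, block_of_le φ h, block_of_le φ h, iota_add]
    exact map_add (restrict φ k) _ _
  · rw [block_of_not_le φ h, block_of_not_le φ h, block_of_not_le φ h]
    exact (add_zero _).symm

theorem block_smul (k q p : ℕ) (c : ℂ) (S : compacts A (tensorPow φ p)) :
    block φ k q p (c • S) = c • block φ k q p S := by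
  by_cases h : p ≤ q
  · rw [block_of_le φ h, block_of_le φ h, iota_smul]
    exact map_smul (restrict φ k) c _
  · rw [block_of_not_le φ h, block_of_not_le φ h]
    exact (smul_zero c).symm

/-- The map `ι̃_p^n` as a linear map. -/
def iotaTildeLM (n p : ℕ) : compacts A (tensorPow φ p) →ₗ[ℂ] BlockAlgebra φ n where
  toFun := iotaTilde φ n p
  map_add' S T := funext fun q => block_add φ (n - q) q p S T
  map_smul' c S := funext fun q => block_smul φ (n - q) q p c S

theorem iotaTilde_zero (n p : ℕ) : iotaTilde φ n p 0 = 0 := map_zero (iotaTildeLM φ n p)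

/-- The target starts at degree 2: passing from `X_0 = A` to `X_1 = X` is not an amplification here,
since `X_1` is not defined as `A ⊗_φ X` and `φ` may be degenerate. -/
theorem iota_succ_of_le {p q : ℕ} (h : p ≤ q + 1) (S : compacts A (tensorPow φ p)) :
    iota φ p (q + 2) S = tensorOnePow φ q (iota φ p (q + 1) S) := by
  match p, h with
  | 0, _ => rw [iota_zero_left, iota_zero_left, leftAction_succ]
  | p + 1, h =>
    rw [iota_succ_succ, iota_succ_succ, amplify_of_le φ (Nat.le_of_succ_le_succ h)]

/-- `∑_{p ≤ k} ι_p^k(S_p)`. -/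
def iotaSum (S : (p : ℕ) → compacts A (tensorPow φ p)) (k : ℕ) : Adjointable A (tensorPow φ k) :=
  ∑ p ∈ Finset.range (k + 1), iota φ p k (S p)

theorem iotaSum_zero (S : (p : ℕ) → compacts A (tensorPow φ p)) : iotaSum φ S 0 = (S 0).1 := by
  rw [iotaSum, Finset.sum_range_one, iota_self]

theorem iotaSum_one (S : (p : ℕ) → compacts A (tensorPow φ p)) :
    iotaSum φ S 1 = leftAction φ 1 (ofCompact (S 0)) + (S 1).1 := by
  rw [iotaSum, Finset.sum_range_succ, Finset.sum_range_one, iota_self, iota_zero_left]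

theorem iotaSum_succ (S : (p : ℕ) → compacts A (tensorPow φ p)) (k : ℕ) :
    iotaSum φ S (k + 2) = tensorOnePow φ k (iotaSum φ S (k + 1)) + (S (k + 2)).1 := by
  refine (Finset.sum_range_succ _ _).trans ?_
  rw [iota_self, iotaSum, map_sum]
  exact congrArg (· + (S (k + 2)).1) (Finset.sum_congr rfl fun p hp =>
    iota_succ_of_le φ (Nat.le_of_lt_succ (Finset.mem_range.mp hp)) (S p))

/-- The `q`-th component of the `ι̃`-sum sees only `p ≤ q`, the other blocks being zero by
definition. This turns the hypothesis of the main implication into conditions on the `R_q`. -/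
theorem restrict_iotaSum (S : (p : ℕ) → compacts A (tensorPow φ p)) {n q : ℕ} (hq : q ≤ n) :
    restrict φ (n - q) (iotaSum φ S q) =
      (∑ p ∈ Finset.range (n + 1), iotaTilde φ n p (S p)) ⟨q, Nat.lt_succ_of_le hq⟩ := by
  refine Eq.trans ?_ (Finset.sum_apply (⟨q, Nat.lt_succ_of_le hq⟩ : Fin (n + 1))
    (Finset.range (n + 1)) (fun p => iotaTilde φ n p (S p))).symm
  rw [iotaSum, map_sum]
  refine Eq.trans (Finset.sum_congr rfl fun p hp => ?_) (Finset.sum_subset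
    (Finset.range_subset_range.mpr (Nat.succ_le_succ hq)) fun p _ hp => ?_)
  · exact (block_of_le φ (Nat.le_of_lt_succ (Finset.mem_range.mp hp)) (S p)).symm
  · exact block_of_not_le φ (fun h => hp (Finset.mem_range.mpr (Nat.lt_succ_of_le h))) (S p)

/-! ### The maps `t^{(n)}`: products, Nica covariance and the descent -/

namespace BimoduleRep

variable {φ} (ψ : BimoduleRep φ B)

/-- Both sides act in the same way on `π(A)`, so the difference `d` kills `π(A)` from the left. As
`d^*` is a difference of an image of `𝓚(A)` and an element of `π(A)`, `d d^* = 0`. -/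
theorem compactRep_zero (S : compacts A (tensorPow φ 0)) :
    ψ.compactRep 0 S = ψ.π (ofCompact S) := by
  have h1 : ∀ (S : compacts A (tensorPow φ 0)) (z : A),
      (ψ.compactRep 0 S - ψ.π (ofCompact S)) * ψ.π z = 0 := fun S z => by
    have e := (ψ.tpow 0).compactMap_mul_toLM S z
    have e2 : S.1.1 z = ofCompact S * z :=
      congrArg (fun T : Adjointable A (HilbertMod.unit A) => T.1 z) (leftMul_ofCompact S).symm
    rw [e2] at e
    rw [sub_mul, ← map_mul, sub_eq_zero]
    exact e
  have h2 : star (ψ.compactRep 0 S - ψ.π (ofCompact S)) =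
      ψ.compactRep 0 ⟨_, star_mem_compacts S.2⟩ - ψ.π (star (ofCompact S)) := by
    rw [star_sub]
    exact congrArg₂ (· - ·) ((ψ.tpow 0).compactMap_star S ⟨_, star_mem_compacts S.2⟩ rfl).symm
      (map_star ψ.π _).symm
  rw [← sub_eq_zero, ← CStarRing.mul_star_self_eq_zero_iff, h2, mul_sub, h1, sub_zero]
  exact (ψ.tpow 0).mul_compactMap_eq_zero (h1 S) _

theorem compactRep_mul_tpow {m n : ℕ} (h : m ≤ n) (S : compacts A (tensorPow φ m))
    (z : tensorPow φ n) :
    ψ.compactRep m S * (ψ.tpow n).toLM z = (ψ.tpow n).toLM ((iota φ m n S).1 z) := by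
  induction n, h using Nat.le_induction with
  | base => exact ((ψ.tpow m).compactMap_mul_toLM S z).trans (by rw [iota_self])
  | succ n h ih =>
    match n, h with
    -- From degree 0 to degree 1 the claim is the axiom `π(a) t(ξ) = t(φ(a) ξ)`; later steps
    -- amplify.
    | 0, h =>
      obtain rfl : m = 0 := Nat.le_zero.mp h
      rw [compactRep_zero, iota_zero_left]
      exact ψ.map_left _ z
    | n + 1, h =>
      rw [iota_succ_of_le φ h]
      exact ModuleRep.mul_toLM_tensor (ψ.tpow_tmul n) ih z

theorem compactRep_mul_compactRep {m n : ℕ} (h : m ≤ n) (S : compacts A (tensorPow φ m))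
    (T U : compacts A (tensorPow φ n)) (hU : U.1 = iota φ m n S * T.1) :
    ψ.compactRep m S * ψ.compactRep n T = ψ.compactRep n U :=
  (ψ.tpow n).mul_compactMap_eq _ _ (ψ.compactRep_mul_tpow h S) T U hU

theorem compactRep_star (n : ℕ) (S T : compacts A (tensorPow φ n)) (h : T.1 = star S.1) :
    ψ.compactRep n T = star (ψ.compactRep n S) := (ψ.tpow n).compactMap_star S T h

/-- The adjoint of `compactRep_mul_compactRep`. -/
theorem compactRep_mul_compactRep' {m n : ℕ} (h : m ≤ n) (S : compacts A (tensorPow φ m))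
    (T U : compacts A (tensorPow φ n)) (hU : U.1 = T.1 * iota φ m n S) :
    ψ.compactRep n T * ψ.compactRep m S = ψ.compactRep n U := by
  have e := ψ.compactRep_mul_compactRep h ⟨_, star_mem_compacts S.2⟩ ⟨_, star_mem_compacts T.2⟩
    ⟨_, star_mem_compacts U.2⟩ ((congrArg star hU).trans ((star_mul _ _).trans
      (congrArg (· * _) (iota_star φ m n S _ rfl).symm)))
  rw [ψ.compactRep_star m S ⟨_, _⟩ rfl, ψ.compactRep_star n T ⟨_, _⟩ rfl,
    ψ.compactRep_star n U ⟨_, _⟩ rfl,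
    ← star_mul] at e
  exact star_injective e

/-- Automatic over `ℕ`: the join is one of the two degrees, and the lower factor acts on the higher
level through its amplification. -/
theorem isNicaCovariant : ψ.IsNicaCovariant := by
  intro m n S T
  rcases le_total m n with h | h
  -- The join is replaced by a variable `r`, so that substituting the equality `n = r` avoids casts
  -- between the types `𝓚(X_r)`.
  · have key : ∀ r (_ : n = r) (U : compacts A (tensorPow φ r)),
        U.1 = iota φ m r S * iota φ n r T →
        ψ.compactRep m S * ψ.compactRep n T = ψ.compactRep r U := by
      rintro _ rfl U hU
      exact ψ.compactRep_mul_compactRep h S T U (by rw [hU, iota_self])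
    exact key _ (sup_eq_right.mpr h).symm _ rfl
  · have key : ∀ r (_ : m = r) (U : compacts A (tensorPow φ r)),
        U.1 = iota φ m r S * iota φ n r T →
        ψ.compactRep m S * ψ.compactRep n T = ψ.compactRep r U := by
      rintro _ rfl U hU
      exact ψ.compactRep_mul_compactRep' h T S U (by rw [hU, iota_self])
    exact key _ (sup_eq_left.mpr h).symm _ rfl

theorem compactRep_mem_core (n : ℕ) (S : compacts A (tensorPow φ n)) :
    ψ.compactRep n S ∈ ψ.core := by
  refine compacts_subtype_induction (p := fun S => ψ.compactRep n S ∈ ψ.core)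
    ((Submodule.isClosed_topologicalClosure _).preimage (ψ.compactRep n).continuous)
    ?_ (fun x y => ?_) (fun S T hS hT => ?_) (fun c T hT => ?_) S
  · rw [(ψ.compactRep n).map_zero]; exact zero_mem _
  · rw [compactRep_theta]
    exact Submodule.le_topologicalClosure _ (Submodule.subset_span ⟨n, x, y, rfl⟩)
  · rw [(ψ.compactRep n).map_add]; exact add_mem hS hT
  · rw [(ψ.compactRep n).map_smul]; exact Submodule.smul_mem _ c hT

/-- One step of the descent. For `k ≥ 1` subtracting `S_{k+1}` shows that `R_k ⊗ 1` is compact, and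
the two facts about operators vanishing on `Y ker φ` apply. For `k = 0`, `R_0 = L_a` with `a` in
Katsura's ideal, and covariance applies directly. -/
theorem exists_compactRep_eq (hψ : ψ.IsCuntzPimsnerCovariant)
    (S : (p : ℕ) → compacts A (tensorPow φ p)) (k : ℕ)
    (h0 : restrict φ 1 (iotaSum φ S k) = 0) (h1 : iotaSum φ S (k + 1) ∈ compacts A (tensorPow φ (k + 1))) :
    ∃ h : iotaSum φ S k ∈ compacts A (tensorPow φ k), ψ.compactRep (k + 1) ⟨_, h1⟩ =
      ψ.compactRep k ⟨_, h⟩ + ψ.compactRep (k + 1) (S (k + 1)) := by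
  match k with
  | 0 =>
    have h : iotaSum φ S 0 ∈ compacts A (tensorPow φ 0) := by rw [iotaSum_zero]; exact (S 0).2
    refine ⟨h, ?_⟩
    have hmem : φ (ofCompact (S 0)) ∈ compacts A X := by
      have := sub_mem h1 (S 1).2
      rwa [iotaSum_one, add_sub_cancel_right] at this
    have e0 : (⟨_, h⟩ : compacts A (tensorPow φ 0)) = S 0 := Subtype.ext (iotaSum_zero φ S)
    have e1 : (⟨_, h1⟩ : compacts A (tensorPow φ 1)) = ⟨_, hmem⟩ + S 1 :=
      Subtype.ext (iotaSum_one φ S)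
    rw [e0, e1, (ψ.compactRep 1).map_add, compactRep_zero, hψ _ hmem fun b hb => ?_]
    · rfl
    · have hb1 : (show tensorPow φ 0 from b) ∈ idealSub φ (tensorPow φ 0) 1 :=
        (mem_idealSub_one φ).mpr <| (map_mul φ (star b) b).trans (by rw [hb, mul_zero])
      have h2 := (restrict_eq_zero_iff φ).mp h0 b hb1
      rw [iotaSum_zero] at h2
      exact (congrArg (fun T : Adjointable A (HilbertMod.unit A) => T.1 b)
        (leftMul_ofCompact (S 0))).trans h2
  | k + 1 =>
    have hT : BalancedTensor.tensorOne φ (iotaSum φ S (k + 1)) ∈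
        compacts A (BalancedTensor (tensorPow φ (k + 1)) φ) := by
      have := sub_mem h1 (S (k + 2)).2
      rwa [iotaSum_succ, add_sub_cancel_right] at this
    have h := mem_compacts_of_tensorOne hT h0
    have e1 : (⟨_, h1⟩ : compacts A (tensorPow φ (k + 2))) =
        (⟨_, hT⟩ : compacts A (tensorPow φ (k + 2))) + S (k + 2) :=
      Subtype.ext (iotaSum_succ φ S k)
    refine ⟨h, ?_⟩
    rw [e1, (ψ.compactRep (k + 2)).map_add]
    exact congrArg (· + _) (ModuleRep.compactMap_eq_compactMap_tensorOne hψ (ψ.tpow_tmul k)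
      ⟨_, h⟩ hT h0).symm

/-- The main implication, by downward induction from `R_n = 0` to `R_0 = S_0`. -/
theorem sum_compactRep_eq_zero (hψ : ψ.IsCuntzPimsnerCovariant) (n : ℕ)
    (S : (p : ℕ) → compacts A (tensorPow φ p))
    (hS : ∑ p ∈ Finset.range (n + 1), iotaTilde φ n p (S p) = 0) :
    ∑ p ∈ Finset.range (n + 1), ψ.compactRep p (S p) = 0 := by
  have hr : ∀ q ≤ n, restrict φ (n - q) (iotaSum φ S q) = 0 := fun q hq =>
    (restrict_iotaSum φ S hq).trans (by rw [hS]; rfl)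
  -- At `q = n` the ideal is `I_0 = A`, so nothing is lost by restricting.
  have hn : iotaSum φ S n = 0 := by
    have h := hr n le_rfl
    rw [Nat.sub_self] at h
    exact eq_zero_of_restrict_zero φ h
  -- The invariant says that `-t^{(k)}(R_k)` is the tail `∑_{k < p ≤ n} t^{(p)}(S_p)`. At `k = 0` it
  -- reads total `+ t^{(0)}(S_0) = t^{(0)}(S_0)`.
  have key : ∀ k ≤ n, ∃ h : iotaSum φ S k ∈ compacts A (tensorPow φ k),
      ∑ p ∈ Finset.range (n + 1), ψ.compactRep p (S p) + ψ.compactRep k ⟨_, h⟩ =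
        ∑ p ∈ Finset.range (k + 1), ψ.compactRep p (S p) := by
    intro k hk
    induction hk using Nat.decreasingInduction with
    | self =>
      have h : iotaSum φ S n ∈ compacts A (tensorPow φ n) := hn ▸ zero_mem _
      have e : (⟨_, h⟩ : compacts A (tensorPow φ n)) = 0 := Subtype.ext hn
      exact ⟨h, by rw [e, (ψ.compactRep n).map_zero, add_zero]⟩
    | of_succ k hk ih =>
      obtain ⟨h1, e1⟩ := ih
      obtain ⟨h, e⟩ := ψ.exists_compactRep_eq hψ S k
        (restrict_one_eq_zero φ (Nat.sub_pos_of_lt hk) (hr k hk.le)) h1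
      refine ⟨h, ?_⟩
      rw [e, Finset.sum_range_succ _ (k + 1), ← add_assoc] at e1
      exact add_right_cancel e1
  obtain ⟨h, e⟩ := key 0 n.zero_le
  have e0 : (⟨_, h⟩ : compacts A (tensorPow φ 0)) = S 0 := Subtype.ext (iotaSum_zero φ S)
  rw [Finset.sum_range_one, e0] at e
  exact add_eq_right.mp e

end BimoduleRep
end Powers

/-! ### The graph of `κ_n` and the equivalence of the three conditions -/

section Covariance

variable {A X : Type u} [NonUnitalCStarAlgebra A] [PartialOrder A] [StarOrderedRing A]
  [NormedAddCommGroup X] [NormedSpace ℂ X] [CompleteSpace X] [HilbertModule A X]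
  {φ : A →⋆ₙₐ[ℂ] Adjointable A X} {B : Type v} [NonUnitalCStarAlgebra B]

theorem restrict_neg {Y : Type*} [NormedAddCommGroup Y] [NormedSpace ℂ Y] [HilbertModule A Y]
    (n : ℕ) (T : Adjointable A Y) : restrict φ n (-T) = -restrict φ n T :=
  map_neg (restrict φ n) T

namespace BimoduleRep

variable (ψ : BimoduleRep φ B)

/-- The pairs `(∑_{p ≤ n} ι̃_p^n(S_p), ∑_{p ≤ n} t^{(p)}(S_p))`. -/
def kappaGraph (n : ℕ) : Submodule ℂ (BlockAlgebra φ n × B) :=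
  LinearMap.range (∑ p : Fin (n + 1),
    ((iotaTildeLM φ n p).prod (ψ.compactRep p : _ →ₗ[ℂ] B)).comp (LinearMap.proj p) :
    ((p : Fin (n + 1)) → compacts A (tensorPow φ p)) →ₗ[ℂ] BlockAlgebra φ n × B)

variable {ψ} in
theorem mem_kappaGraph {n : ℕ} {z : BlockAlgebra φ n × B} : z ∈ ψ.kappaGraph n ↔
    ∃ S : (p : Fin (n + 1)) → compacts A (tensorPow φ p),
      ∑ p : Fin (n + 1), (iotaTilde φ n p (S p), ψ.compactRep p (S p)) = z := by
  refine exists_congr fun S => ?_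
  rw [LinearMap.sum_apply]
  rfl

theorem pair_mem_kappaGraph {n p : ℕ} (hp : p ≤ n) (S : compacts A (tensorPow φ p)) :
    (iotaTilde φ n p S, ψ.compactRep p S) ∈ ψ.kappaGraph n := by
  let p' : Fin (n + 1) := ⟨p, Nat.lt_succ_of_le hp⟩
  refine mem_kappaGraph.mpr
    ⟨Pi.single (M := fun p : Fin (n + 1) => compacts A (tensorPow φ p)) p' S, ?_⟩
  rw [Finset.sum_eq_single p' (fun q _ hq => ?_) fun h => absurd (Finset.mem_univ _) h]
  · rw [Pi.single_eq_same]
  · rw [Pi.single_eq_of_ne hq, iotaTilde_zero, (ψ.compactRep q).map_zero]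
    rfl

theorem star_mem_kappaGraph {n : ℕ} {z : BlockAlgebra φ n × B} (hz : z ∈ ψ.kappaGraph n) :
    star z ∈ ψ.kappaGraph n := by
  obtain ⟨S, rfl⟩ := mem_kappaGraph.mp hz
  rw [star_sum]
  refine sum_mem fun p _ => ?_
  have h : star (iotaTilde φ n p (S p), ψ.compactRep p (S p)) =
      (iotaTilde φ n p ⟨_, star_mem_compacts (S p).2⟩,
        ψ.compactRep p ⟨_, star_mem_compacts (S p).2⟩) :=
    Prod.ext (iotaTilde_star φ n p _ _ rfl) (ψ.compactRep_star p _ _ rfl).symm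
  exact h ▸ ψ.pair_mem_kappaGraph p.is_le _

/-- For `p ≤ q` both coordinates multiply by the same rule, with the product `ι_p^q(S) T` at level
`q`. The case `q ≤ p` follows by taking adjoints. -/
theorem pair_mul_pair_mem_kappaGraph {n p q : ℕ} (hp : p ≤ n) (hq : q ≤ n)
    (S : compacts A (tensorPow φ p)) (T : compacts A (tensorPow φ q)) :
    (iotaTilde φ n p S, ψ.compactRep p S) * (iotaTilde φ n q T, ψ.compactRep q T) ∈
      ψ.kappaGraph n := by
  have key : ∀ {p q : ℕ} (_ : p ≤ q) (_ : q ≤ n) (S : compacts A (tensorPow φ p))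
      (T : compacts A (tensorPow φ q)),
      (iotaTilde φ n p S, ψ.compactRep p S) * (iotaTilde φ n q T, ψ.compactRep q T) ∈
        ψ.kappaGraph n := fun {p q} hpq hq S T => by
    have h : (iotaTilde φ n p S, ψ.compactRep p S) * (iotaTilde φ n q T, ψ.compactRep q T) =
        (iotaTilde φ n q ⟨_, mul_mem_compacts (iota φ p q S) T.2⟩,
          ψ.compactRep q ⟨_, mul_mem_compacts (iota φ p q S) T.2⟩) :=
      Prod.ext (iotaTilde_mul φ n hpq S T _ rfl) (ψ.compactRep_mul_compactRep hpq S T _ rfl)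
    exact h ▸ ψ.pair_mem_kappaGraph hq _
  rcases le_total p q with h | h
  · exact key h hq S T
  · have e := ψ.star_mem_kappaGraph
      (key h hp ⟨_, star_mem_compacts T.2⟩ ⟨_, star_mem_compacts S.2⟩)
    have hs : ∀ (p : ℕ) (S : compacts A (tensorPow φ p)),
        star (iotaTilde φ n p ⟨_, star_mem_compacts S.2⟩,
          ψ.compactRep p ⟨_, star_mem_compacts S.2⟩) =
        (iotaTilde φ n p S, ψ.compactRep p S) := fun p S =>
      Prod.ext (iotaTilde_star φ n p _ _ (star_star _).symm)
        (ψ.compactRep_star p _ _ (star_star _).symm).symm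
    rwa [star_mul, hs, hs] at e

theorem mul_mem_kappaGraph {n : ℕ} {z w : BlockAlgebra φ n × B} (hz : z ∈ ψ.kappaGraph n)
    (hw : w ∈ ψ.kappaGraph n) : z * w ∈ ψ.kappaGraph n := by
  obtain ⟨S, rfl⟩ := mem_kappaGraph.mp hz
  obtain ⟨T, rfl⟩ := mem_kappaGraph.mp hw
  rw [Finset.sum_mul_sum]
  exact sum_mem fun p _ => sum_mem fun q _ => ψ.pair_mul_pair_mem_kappaGraph p.is_le q.is_le _ _

theorem exists_mem_kappaGraph {n : ℕ} {x : BlockAlgebra φ n} (hx : x ∈ blockSubalgebra φ n) :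
    ∃ b, (x, b) ∈ ψ.kappaGraph n := by
  refine Submodule.span_induction (p := fun x _ => ∃ b, (x, b) ∈ ψ.kappaGraph n) ?_
    ⟨0, zero_mem _⟩ ?_ ?_ hx
  · rintro _ ⟨p, hp, S, rfl⟩
    exact ⟨_, ψ.pair_mem_kappaGraph hp S⟩
  · rintro x y _ _ ⟨b, hb⟩ ⟨c, hc⟩
    exact ⟨b + c, add_mem hb hc⟩
  · rintro r x _ ⟨b, hb⟩
    exact ⟨r • b, Submodule.smul_mem _ r hb⟩

theorem mem_core_of_mem_kappaGraph {n : ℕ} {z : BlockAlgebra φ n × B}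
    (hz : z ∈ ψ.kappaGraph n) : z.2 ∈ ψ.core := by
  obtain ⟨S, rfl⟩ := mem_kappaGraph.mp hz
  rw [Prod.snd_sum]
  exact sum_mem fun p _ => ψ.compactRep_mem_core p (S p)

variable {ψ}

/-- Single-valuedness of `κ_n`: the main implication, with the finite family extended by zero to all
of `ℕ`. -/
theorem IsCuntzPimsnerCovariant.eq_zero_of_mem_kappaGraph (hψ : ψ.IsCuntzPimsnerCovariant)
    {n : ℕ} {b : B} (hb : (0, b) ∈ ψ.kappaGraph n) : b = 0 := by
  obtain ⟨S, hS⟩ := mem_kappaGraph.mp hb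
  let S' : (p : ℕ) → compacts A (tensorPow φ p) :=
    fun p => if h : p < n + 1 then S ⟨p, h⟩ else 0
  have hS' : ∀ p : Fin (n + 1), S' p = S p := fun p => dif_pos p.2
  have h1 : ∑ p ∈ Finset.range (n + 1), iotaTilde φ n p (S' p) = 0 := by
    rw [Finset.sum_range]
    simp_rw [hS']
    simpa only [Prod.fst_sum] using congrArg Prod.fst hS
  have h2 := ψ.sum_compactRep_eq_zero hψ n S' h1
  rw [Finset.sum_range] at h2
  simp_rw [hS'] at h2
  rw [← h2]
  simpa only [Prod.snd_sum] using (congrArg Prod.snd hS).symm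

/-- The graph is a subspace closed under products and adjoints, so single-valuedness makes any
choice of values a `*`-homomorphism. -/
theorem IsCuntzPimsnerCovariant.kappaIsStarHom (hψ : ψ.IsCuntzPimsnerCovariant) (n : ℕ) :
    ψ.KappaIsStarHom n := by
  have huniq : ∀ {x : BlockAlgebra φ n} {b c : B}, (x, b) ∈ ψ.kappaGraph n →
      (x, c) ∈ ψ.kappaGraph n → b = c := fun {x b c} hb hc => by
    have h := sub_mem hb hc
    rw [Prod.mk_sub_mk, sub_self] at h
    exact sub_eq_zero.mp (hψ.eq_zero_of_mem_kappaGraph h)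
  choose κ hκ using fun x : blockSubalgebra φ n => ψ.exists_mem_kappaGraph x.2
  refine ⟨{ toFun := κ
            map_smul' := fun c x => huniq (hκ _) (Submodule.smul_mem _ c (hκ x))
            map_zero' := huniq (hκ _) (zero_mem _)
            map_add' := fun x y => huniq (hκ _) (add_mem (hκ x) (hκ y))
            map_mul' := fun x y => huniq (hκ _) (ψ.mul_mem_kappaGraph (hκ x) (hκ y))
            map_star' := fun x => huniq (hκ _) (ψ.star_mem_kappaGraph (hκ x)) },
    fun x => ψ.mem_core_of_mem_kappaGraph (hκ x), fun S => huniq (hκ _) ?_⟩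
  refine mem_kappaGraph.mpr ⟨S, Prod.ext ?_ ?_⟩
  · rw [Prod.fst_sum, AddSubmonoidClass.coe_finsetSum]
  · rw [Prod.snd_sum]

theorem IsCuntzPimsnerCovariant.isCNPCovariant (hψ : ψ.IsCuntzPimsnerCovariant) :
    ψ.IsCNPCovariant := by
  refine ⟨ψ.isNicaCovariant, fun F S hS => ?_⟩
  -- A single level `m` with `m ≥ max F` is enough; the family is set to zero off `F` so that the
  -- sum runs over all `p ≤ m`.
  obtain ⟨m, hm, h⟩ := hS (F.sup id)
  let S' : (p : ℕ) → compacts A (tensorPow φ p) := fun p => if p ∈ F then S p else 0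
  have hF : F ⊆ Finset.range (m + 1) := fun p hp =>
    Finset.mem_range.mpr (Nat.lt_succ_of_le ((Finset.le_sup (f := id) hp).trans hm))
  have hmem : ∀ p ∈ F, S' p = S p := fun p hp => if_pos hp
  have hnot : ∀ p ∉ F, S' p = 0 := fun p hp => if_neg hp
  have h1 : ∑ p ∈ Finset.range (m + 1), iotaTilde φ m p (S' p) = 0 := by
    rw [← h m le_rfl, ← Finset.sum_subset hF fun p _ hp => by rw [hnot p hp, iotaTilde_zero]]
    exact Finset.sum_congr rfl fun p hp => by rw [hmem p hp]
  rw [← ψ.sum_compactRep_eq_zero hψ m S' h1,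
    ← Finset.sum_subset hF fun p _ hp => by rw [hnot p hp, (ψ.compactRep p).map_zero]]
  exact Finset.sum_congr rfl fun p hp => by rw [hmem p hp]

/-- The family `(L_a, -φ(a), 0, 0, …)`. -/
def covarianceFamily (a : A) (ha : φ a ∈ compacts A X) : (p : ℕ) → compacts A (tensorPow φ p)
  | 0 => ⟨leftMul A a, leftMul_mem_compacts a⟩
  | 1 => -(⟨φ a, ha⟩ : compacts A X)
  | _ + 2 => 0

/-- Only component 0 uses that `a` annihilates `ker φ`; it needs `q ≥ 1` so that `I_q = ker φ`. In
components `r ≥ 1` the terms `φ_r(a)` and `-φ(a) ⊗ 1` cancel. -/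
theorem sum_iotaTilde_covarianceFamily {a : A} (ha : φ a ∈ compacts A X)
    (hb : ∀ b : A, φ b = 0 → a * b = 0) {q : ℕ} (hq : 1 ≤ q) :
    ∑ p ∈ Finset.range 2, iotaTilde φ q p (covarianceFamily a ha p) = 0 := by
  rw [Finset.sum_range_succ, Finset.sum_range_one]
  refine funext fun ⟨r, hr⟩ => ?_
  change block φ (q - r) r 0 (covarianceFamily a ha 0) +
    block φ (q - r) r 1 (covarianceFamily a ha 1) = 0
  rw [block_of_le φ r.zero_le, iota_zero_left]
  have ea : ofCompact (covarianceFamily a ha 0) = a := ofCompact_leftMul a _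
  rw [ea]
  match r with
  | 0 =>
    rw [block_of_not_le φ (by decide), add_zero, restrict_eq_zero_iff]
    -- Membership of `b` in `A I_q` gives `φ(b^* b) = 0`, and the C*-identity upgrades this to `φ(b)
    -- = 0`.
    have key : ∀ b : A, φ (star b * b) = 0 → a * b = 0 := fun b h => hb b <|
      (CStarRing.star_mul_self_eq_zero_iff (φ b)).mp (by rw [← map_star, ← map_mul, h])
    exact fun b hb' => key b ((mem_idealSub_iff φ hq).mp hb')
  | r + 1 =>
    have e1 : iota φ (0 + 1) (r + 1) (covarianceFamily a ha 1) = -leftAction φ (r + 1) a :=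
      (iota_succ_succ φ 0 r (covarianceFamily a ha 1)).trans
        ((map_neg (amplify φ 0 r) (leftAction φ 1 a)).trans
          (congrArg Neg.neg (amplify_leftAction φ r.zero_le a)))
    have e2 : block φ (q - (r + 1)) (r + 1) (0 + 1) (covarianceFamily a ha 1) =
        -restrict φ (q - (r + 1)) (leftAction φ (r + 1) a) :=
      (block_of_le φ (Nat.succ_le_succ r.zero_le) (covarianceFamily a ha 1)).trans
        ((congrArg (fun T => restrict φ (q - (r + 1)) T) e1).trans (restrict_neg _ _))
    refine Eq.trans ?_ (add_neg_cancel (restrict φ (q - (r + 1)) (leftAction φ (r + 1) a)))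
    exact congrArg (fun T => restrict φ (q - (r + 1)) (leftAction φ (r + 1) a) + T) e2

theorem eq_compactMap_of_sum_compactRep {a : A} (ha : φ a ∈ compacts A X)
    (h : ∑ p ∈ Finset.range 2, ψ.compactRep p (covarianceFamily a ha p) = 0) :
    ψ.π a = ψ.toModuleRep.compactMap ⟨φ a, ha⟩ := by
  have ea : ofCompact (covarianceFamily a ha 0) = a := ofCompact_leftMul a _
  rw [Finset.sum_range_succ, Finset.sum_range_one, compactRep_zero, ea] at h
  have e : ψ.compactRep 1 (covarianceFamily a ha 1) =
      -ψ.toModuleRep.compactMap ⟨φ a, ha⟩ := ψ.toModuleRep.compactMap.map_neg ⟨φ a, ha⟩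
  rw [e, add_neg_eq_zero] at h
  exact h

/-- Level 1 suffices, because the test family lives in degrees 0 and 1. -/
theorem KappaIsStarHom.isCuntzPimsnerCovariant (h : ψ.KappaIsStarHom 1) :
    ψ.IsCuntzPimsnerCovariant := by
  obtain ⟨κ, -, hκ⟩ := h
  intro a ha hb
  refine eq_compactMap_of_sum_compactRep ha ?_
  rw [Finset.sum_range, ← hκ (fun p => covarianceFamily a ha p), ← map_zero κ]
  refine congrArg κ (Subtype.ext ?_)
  rw [AddSubmonoidClass.coe_finsetSum]
  exact (Finset.sum_range fun p => iotaTilde φ 1 p (covarianceFamily a ha p)).symm.trans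
    (sum_iotaTilde_covarianceFamily ha hb le_rfl)

theorem IsCNPCovariant.isCuntzPimsnerCovariant (h : ψ.IsCNPCovariant) :
    ψ.IsCuntzPimsnerCovariant := fun _ ha hb =>
  eq_compactMap_of_sum_compactRep ha <| h.2 _ _ fun n =>
    -- The threshold `n + 1` rather than `n` guarantees `q ≥ 1` even for `n = 0`.
    ⟨n + 1, n.le_succ, fun _ hq => sum_iotaTilde_covarianceFamily ha hb (n.succ_pos.trans_le hq)⟩

end BimoduleRep
end Covariance
end

theorem mainTheorem2 {A X : Type u} {B : Type v}
    [NonUnitalCStarAlgebra A] [PartialOrder A] [StarOrderedRing A]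
    [NormedAddCommGroup X] [NormedSpace ℂ X] [CompleteSpace X] [HilbertModule A X]
    [NonUnitalCStarAlgebra B]
    (φ : A →⋆ₙₐ[ℂ] Adjointable A X) (ψ : BimoduleRep φ B) :
    List.TFAE [
      ψ.IsCuntzPimsnerCovariant,
      ∀ n : ℕ, ψ.KappaIsStarHom n,
      ψ.IsCNPCovariant] := by
  tfae_have 1 → 2 := fun h => h.kappaIsStarHom
  tfae_have 2 → 1 := fun h => (h 1).isCuntzPimsnerCovariant
  tfae_have 1 → 3 := fun h => h.isCNPCovariant
  tfae_have 3 → 1 := fun h => h.isCuntzPimsnerCovariant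
  tfae_finish
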